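/- **Setting.** Let $(\bar M,\bar J,\bar g)$ be an indefinite Kähler manifold: $\bar g$ is a semi-Riemannian metric of constant index $q$, $0<q<\dim\bar M$, with Levi-Civita connection $\bar\nabla$, and $\bar J$ is a $(1,1)$-tensor field with $\bar J^2=-I$, $\bar g(\bar JX,\bar JY)=\bar g(X,Y)$ and $\bar\nabla\bar J=0$. Let $M$ be an (immersed) submanifold of $\bar M$ with induced metric $g$ such that $\mathrm{Rad}(TM)=TM\cap TM^{\perp}$ has constant rank $r\ge 1$ (a lightlike submanifold). Let $S(TM)$ and $S(TM^\perp)$ be a screen distribution and a screen transversal bundle, i.e. non-degenerate subbundles with $$TM=S(TM)\perp \mathrm{Rad}(TM),\qquad TM^\perp=S(TM^\perp)\perp \mathrm{Rad}(TM),$$ and let $ltr(TM)$ be a lightlike transversal bundle: a totally null complement of $\mathrm{Rad}(TM)$ in the orthogonal complement of $S(TM)\perp S(TM^\perp)$ in $T\bar M|_M$. Put $tr(TM)=ltr(TM)\perp S(TM^\perp)$, so that $T\bar M|_M=TM\oplus tr(TM)$. For $X,Y\in\Gamma(TM)$ write $\bar\nabla_XY=\nabla_XY+h(X,Y)$ with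 $\nabla_XY\in\Gamma(TM)$ (the induced connection) and $h(X,Y)\in\Gamma(tr(TM))$, and let $h^l$ be the $ltr(TM)$-part of $h$. $M$ is a *screen transversal Cauchy–Riemann (STCR) lightlike submanifold* if there are subbundles $D_1,D_2$ of $\mathrm{Rad}(TM)$, $D_0,D'$ of $S(TM)$, $L_1$ of $ltr(TM)$ and $S$ of $S(TM^\perp)$, with $D_0$ non-degenerate, such that $$\mathrm{Rad}(TM)=D_1\oplus D_2,\quad \bar J D_1\subset S(TM),\quad \bar J D_2\subset S(TM^\perp),$$ $$S(TM)=\{\bar J D_1\oplus D'\}\perp D_0,\quad \bar J D_0=D_0,\quad \bar J D'=L_1\perp S.$$ $M$ is *totally umbilical* if there is a smooth section $H$ of $tr(TM)$, called a transversal curvature vector field, with $h(X,Y)=g(X,Y)H$ for all $X,Y\in\Gamma(TM)$; the $ltr(TM)$-part of $H$ is denoted $H^l$. **Theorem.** Let $M$ be a totally umbilical STCR lightlike submanifold of an indefinite Kähler manifold $\bar M$, with $D_0\neq\{0\}$ (at every point). If the distribution $D_0$ is integrable, i.e. $[X,Y]\in\Gamma(D_0)$ for all $X,Y\in\Gamma(D_0)$,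 then $H^l=0$ (for every transversal curvature vector field $H$) and $h^l=0$. Hence the induced connection $\nabla$ is a metric connection: $(\nabla_Xg)(Y,Z)=Xg(Y,Z)-g(\nabla_XY,Z)-g(Y,\nabla_XZ)=0$ for all $X,Y,Z\in\Gamma(TM)$. -/

import Mathlib

open Bundle Set Filter
open scoped Manifold ContDiff Topology

noncomputable section

namespace LightlikeGeometry

/-! ### Linear algebra of subspaces -/

section LinearAlgebra

variable {V : Type*} [AddCommGroup V] [Module ℝ V]

/-- `R = P ⊕ Q`. -/
def IsDirectSum (P Q R : Submodule ℝ V) : Prop :=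
  Disjoint P Q ∧ P ⊔ Q = R

/-- `R = P ⊥ Q`: direct sum of two subspaces that are orthogonal with respect to `B`. -/
def IsOrthogonalSum (B : LinearMap.BilinForm ℝ V) (P Q R : Submodule ℝ V) : Prop :=
  IsDirectSum P Q R ∧ ∀ u ∈ P, ∀ w ∈ Q, B u w = 0

/-- `B` restricted to `P` is non-degenerate. -/
def IsNondegenerateOn (B : LinearMap.BilinForm ℝ V) (P : Submodule ℝ V) : Prop :=
  ∀ u ∈ P, (∀ w ∈ P, B u w = 0) → u = 0

/-- If `T = S ⊥ R`, `T^⊥ = C ⊥ R`, `(S ⊥ C)^⊥ = R ⊕ L` and `S`, `C` are non-degenerate, then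
`V = T ⊕ (L ⊕ C)` and `V = L ⊕ (T ⊕ C)`. -/
theorem isCompl_of_decomposition [FiniteDimensional ℝ V] {B : LinearMap.BilinForm ℝ V}
    (hB : B.IsSymm) {T S R L C : Submodule ℝ V}
    (hS : IsOrthogonalSum B S R T) (hC : IsOrthogonalSum B C R (B.orthogonal T))
    (hSn : IsNondegenerateOn B S) (hCn : IsNondegenerateOn B C)
    (hL : IsDirectSum R L (B.orthogonal (S ⊔ C))) :
    IsCompl T (L ⊔ C) ∧ IsCompl L (T ⊔ C) := by
  obtain ⟨⟨hSd, hSs⟩, -⟩ := hS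
  obtain ⟨⟨-, hCs⟩, -⟩ := hC
  obtain ⟨hLd, hLs⟩ := hL
  have hST : S ≤ T := hSs ▸ le_sup_left
  have hCT : C ≤ B.orthogonal T := hCs ▸ le_sup_left
  have hsc : ∀ s ∈ S, ∀ c ∈ C, B s c = 0 := fun s hs c hc ↦ hCT hc s (hST hs)
  have hnd : ∀ s ∈ S, ∀ c ∈ C, s + c ∈ B.orthogonal (S ⊔ C) → s = 0 ∧ c = 0 := by
    intro s hs c hc h
    constructor
    · refine hSn s hs fun w hw ↦ ?_
      have h1 : B w (s + c) = 0 := h w (le_sup_left (a := S) (b := C) hw)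
      rw [map_add, hsc w hw c hc, add_zero] at h1
      rw [← hB.eq s w] at h1
      simpa using h1
    · refine hCn c hc fun w hw ↦ ?_
      have h1 : B w (s + c) = 0 := h w (le_sup_right (a := S) (b := C) hw)
      have h2 : B w s = 0 := by rw [← hB.eq s w]; simpa using hsc s hs w hw
      rw [map_add, h2, zero_add] at h1
      rw [← hB.eq w c]; simpa using h1
  have hW : IsCompl (S ⊔ C) (B.orthogonal (S ⊔ C)) := by
    apply LinearMap.BilinForm.isCompl_orthogonal_of_restrict_nondegenerate hB.isRefl
    apply LinearMap.BilinForm.nondegenerate_restrict_of_disjoint_orthogonal B hB.isRefl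
    rw [Submodule.disjoint_def]
    intro w hw hw'
    obtain ⟨s, hs, c, hc, rfl⟩ := Submodule.mem_sup.1 hw
    obtain ⟨h1, h2⟩ := hnd s hs c hc hw'
    simp [h1, h2]
  have htop : T ⊔ (L ⊔ C) = ⊤ := by
    have := hW.sup_eq_top
    rw [← hLs] at this
    rw [← this, ← hSs]
    ac_rfl
  have hRL : R ⊔ L ≤ B.orthogonal (S ⊔ C) := hLs.le
  have key : ∀ s ∈ S, ∀ ρ ∈ R, ∀ l ∈ L, ∀ c ∈ C, s + ρ + l + c = 0 →
      s = 0 ∧ ρ = 0 ∧ l = 0 ∧ c = 0 := by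
    intro s hs ρ hρ l hl c hc h
    have h1 : s + c = -(ρ + l) := by
      rw [eq_neg_iff_add_eq_zero, ← h]; abel
    have h2 : s + c ∈ B.orthogonal (S ⊔ C) := by
      rw [h1]
      exact neg_mem (hRL (Submodule.add_mem_sup hρ hl))
    obtain ⟨rfl, rfl⟩ := hnd s hs c hc h2
    have h3 : ρ = -l := by
      rw [eq_neg_iff_add_eq_zero]; simpa using h
    have h4 : ρ = 0 := Submodule.disjoint_def.1 hLd ρ hρ (h3 ▸ neg_mem hl)
    refine ⟨rfl, h4, ?_, rfl⟩
    rw [h4, eq_comm, neg_eq_zero] at h3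
    exact h3
  refine ⟨⟨?_, codisjoint_iff.2 htop⟩, ⟨?_, codisjoint_iff.2 ?_⟩⟩
  · rw [Submodule.disjoint_def]
    intro w hw hw'
    rw [← hSs] at hw
    obtain ⟨s, hs, ρ, hρ, rfl⟩ := Submodule.mem_sup.1 hw
    obtain ⟨l, hl, c, hc, h⟩ := Submodule.mem_sup.1 hw'
    obtain ⟨h1, h2, -, -⟩ := key s hs ρ hρ (-l) (neg_mem hl) (-c) (neg_mem hc) (by
      rw [← h]; abel)
    simp [h1, h2]
  · rw [Submodule.disjoint_def]
    intro l hl hw'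
    obtain ⟨t, ht, c, hc, h⟩ := Submodule.mem_sup.1 hw'
    rw [← hSs] at ht
    obtain ⟨s, hs, ρ, hρ, rfl⟩ := Submodule.mem_sup.1 ht
    obtain ⟨-, -, h3, -⟩ := key s hs ρ hρ (-l) (neg_mem hl) c hc (by rw [← h]; abel)
    simpa using h3
  · rw [← htop]; ac_rfl

end LinearAlgebra

/-! ### The ambient manifold -/

section Ambient

variable (F : Type*) [NormedAddCommGroup F] [NormedSpace ℝ F] [FiniteDimensional ℝ F]
  (N : Type*) [TopologicalSpace N] [ChartedSpace F N] [IsManifold 𝓘(ℝ, F) ∞ N]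

/-- A proper (neither positive nor negative definite) semi-Riemannian metric on `N`: a smooth
field of non-degenerate symmetric bilinear forms of constant index `q`, `0 < q < dim N`. -/
structure SemiRiemannianMetric where
  toFun (p : N) : TangentSpace 𝓘(ℝ, F) p →L[ℝ] TangentSpace 𝓘(ℝ, F) p →L[ℝ] ℝ
  smooth : ContMDiff 𝓘(ℝ, F) (𝓘(ℝ, F).prod 𝓘(ℝ, F →L[ℝ] F →L[ℝ] ℝ)) ∞
    (fun p ↦ TotalSpace.mk' (F →L[ℝ] F →L[ℝ] ℝ)
      (E := fun p : N ↦ TangentSpace 𝓘(ℝ, F) p →L[ℝ] TangentSpace 𝓘(ℝ, F) p →L[ℝ] ℝ) p (toFun p))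
  symm (p : N) (v w : TangentSpace 𝓘(ℝ, F) p) : toFun p v w = toFun p w v
  nondegenerate (p : N) (v : TangentSpace 𝓘(ℝ, F) p) : (∀ w, toFun p v w = 0) → v = 0
  index : ℕ
  index_pos : 0 < index
  index_lt : index < Module.finrank ℝ F
  sigNeg_eq (p : N) : sigNeg (LinearMap.BilinMap.toQuadraticMap (toFun p).toBilinForm) = index

variable {F N}

/-- The metric at `p` as a bilinear form. -/
def SemiRiemannianMetric.form (g : SemiRiemannianMetric F N) (p : N) :
    LinearMap.BilinForm ℝ (TangentSpace 𝓘(ℝ, F) p) :=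
  (g.toFun p).toBilinForm

theorem SemiRiemannianMetric.form_isSymm (g : SemiRiemannianMetric F N) (p : N) :
    (g.form p).IsSymm :=
  ⟨fun v w ↦ g.symm p v w⟩

/-- `D` is the Levi-Civita connection of `g`: it is torsion-free and metric. Recall that
`D Y p (X p)` is `(∇_X Y)(p)`. -/
structure IsLeviCivita (g : SemiRiemannianMetric F N)
    (D : CovariantDerivative 𝓘(ℝ, F) F (TangentSpace 𝓘(ℝ, F) : N → Type _)) : Prop where
  torsion_free (X Y : Π p : N, TangentSpace 𝓘(ℝ, F) p) (p : N)
    (hX : MDifferentiableAt 𝓘(ℝ, F) 𝓘(ℝ, F).tangent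
      (fun q ↦ (⟨q, X q⟩ : TangentBundle 𝓘(ℝ, F) N)) p)
    (hY : MDifferentiableAt 𝓘(ℝ, F) 𝓘(ℝ, F).tangent
      (fun q ↦ (⟨q, Y q⟩ : TangentBundle 𝓘(ℝ, F) N)) p) :
    D Y p (X p) - D X p (Y p) = VectorField.mlieBracket 𝓘(ℝ, F) X Y p
  metric (Y Z : Π p : N, TangentSpace 𝓘(ℝ, F) p) (p : N)
    (hY : MDifferentiableAt 𝓘(ℝ, F) 𝓘(ℝ, F).tangent
      (fun q ↦ (⟨q, Y q⟩ : TangentBundle 𝓘(ℝ, F) N)) p)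
    (hZ : MDifferentiableAt 𝓘(ℝ, F) 𝓘(ℝ, F).tangent
      (fun q ↦ (⟨q, Z q⟩ : TangentBundle 𝓘(ℝ, F) N)) p)
    (v : TangentSpace 𝓘(ℝ, F) p) :
    mvfderiv 𝓘(ℝ, F) (fun q ↦ g.toFun q (Y q) (Z q)) p v =
      g.toFun p (D Y p v) (Z p) + g.toFun p (Y p) (D Z p v)

/-- `(N, J, g)` is an indefinite Kähler manifold, `D` being the Levi-Civita connection of `g`:
`J` is a smooth tensor field of type (1,1) with `J² = -1`, `g` is Hermitian and `∇ J = 0`. -/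
structure IsIndefiniteKahler (g : SemiRiemannianMetric F N)
    (D : CovariantDerivative 𝓘(ℝ, F) F (TangentSpace 𝓘(ℝ, F) : N → Type _))
    (J : Π p : N, TangentSpace 𝓘(ℝ, F) p →L[ℝ] TangentSpace 𝓘(ℝ, F) p) : Prop where
  smooth : ContMDiff 𝓘(ℝ, F) (𝓘(ℝ, F).prod 𝓘(ℝ, F →L[ℝ] F)) ∞
    (fun p ↦ TotalSpace.mk' (F →L[ℝ] F)
      (E := fun p : N ↦ TangentSpace 𝓘(ℝ, F) p →L[ℝ] TangentSpace 𝓘(ℝ, F) p) p (J p))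
  sq (p : N) (v : TangentSpace 𝓘(ℝ, F) p) : J p (J p v) = -v
  hermitian (p : N) (v w : TangentSpace 𝓘(ℝ, F) p) :
    g.toFun p (J p v) (J p w) = g.toFun p v w
  leviCivita : IsLeviCivita g D
  parallel (Y : Π p : N, TangentSpace 𝓘(ℝ, F) p) (p : N)
    (hY : MDifferentiableAt 𝓘(ℝ, F) 𝓘(ℝ, F).tangent
      (fun q ↦ (⟨q, Y q⟩ : TangentBundle 𝓘(ℝ, F) N)) p)
    (v : TangentSpace 𝓘(ℝ, F) p) :
    D (fun q ↦ J q (Y q)) p v = J p (D Y p v)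

end Ambient

/-! ### Vector fields and vector subbundles on, and along, a submanifold `f : M → N` -/

section Along

variable {E : Type*} [NormedAddCommGroup E] [NormedSpace ℝ E] [FiniteDimensional ℝ E]
  {M : Type*} [TopologicalSpace M] [ChartedSpace E M] [IsManifold 𝓘(ℝ, E) ∞ M]
  {F : Type*} [NormedAddCommGroup F] [NormedSpace ℝ F] [FiniteDimensional ℝ F]
  {N : Type*} [TopologicalSpace N] [ChartedSpace F N] [IsManifold 𝓘(ℝ, F) ∞ N]

/-- `P` is a smooth distribution on `M`, i.e. a vector subbundle of `TM`: around each point it is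
spanned by smooth vector fields that are linearly independent at each point. -/
def IsDistribution (P : Π x : M, Submodule ℝ (TangentSpace 𝓘(ℝ, E) x)) : Prop :=
  ∀ x₀ : M, ∃ (k : ℕ) (s : Fin k → Π x : M, TangentSpace 𝓘(ℝ, E) x), ∀ᶠ x in 𝓝 x₀,
    (∀ i, ContMDiffAt 𝓘(ℝ, E) 𝓘(ℝ, E).tangent ∞
      (fun y ↦ (⟨y, s i y⟩ : TangentBundle 𝓘(ℝ, E) M)) x) ∧
    LinearIndependent ℝ (fun i ↦ s i x) ∧ Submodule.span ℝ (range fun i ↦ s i x) = P x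

variable (E) in
/-- `P` is a smooth vector subbundle of `TN` restricted to `M`. -/
def IsSubbundleAlong (f : M → N)
    (P : Π x : M, Submodule ℝ (TangentSpace 𝓘(ℝ, F) (f x))) : Prop :=
  ∀ x₀ : M, ∃ (k : ℕ) (s : Fin k → Π x : M, TangentSpace 𝓘(ℝ, F) (f x)), ∀ᶠ x in 𝓝 x₀,
    (∀ i, ContMDiffAt 𝓘(ℝ, E) 𝓘(ℝ, F).tangent ∞
      (fun y ↦ (⟨f y, s i y⟩ : TangentBundle 𝓘(ℝ, F) N)) x) ∧
    LinearIndependent ℝ (fun i ↦ s i x) ∧ Submodule.span ℝ (range fun i ↦ s i x) = P x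

/-- A distribution `P` on `M` is integrable if `[X, Y] ∈ Γ(P)` for all (local) smooth sections
`X, Y` of `P`. -/
def IsIntegrable (P : Π x : M, Submodule ℝ (TangentSpace 𝓘(ℝ, E) x)) : Prop :=
  ∀ (X Y : Π x : M, TangentSpace 𝓘(ℝ, E) x) (U : Set M), IsOpen U →
    ContMDiffOn 𝓘(ℝ, E) 𝓘(ℝ, E).tangent ∞ (fun y ↦ (⟨y, X y⟩ : TangentBundle 𝓘(ℝ, E) M)) U →
    ContMDiffOn 𝓘(ℝ, E) 𝓘(ℝ, E).tangent ∞ (fun y ↦ (⟨y, Y y⟩ : TangentBundle 𝓘(ℝ, E) M)) U →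
    (∀ x ∈ U, X x ∈ P x ∧ Y x ∈ P x) → ∀ x ∈ U, VectorField.mlieBracket 𝓘(ℝ, E) X Y x ∈ P x

/-- A vector field on `M`, differentiable at `x`. -/
def FieldDiffAt (Y : Π x : M, TangentSpace 𝓘(ℝ, E) x) (x : M) : Prop :=
  MDifferentiableAt 𝓘(ℝ, E) 𝓘(ℝ, E).tangent (fun y ↦ (⟨y, Y y⟩ : TangentBundle 𝓘(ℝ, E) M)) x

/-- The subspace of `T_{f x} N` to which `df` maps the subspace `P` of `T_x M`. -/
def push (f : M → N) (x : M) (P : Submodule ℝ (TangentSpace 𝓘(ℝ, E) x)) :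
    Submodule ℝ (TangentSpace 𝓘(ℝ, F) (f x)) :=
  P.map (mfderiv 𝓘(ℝ, E) 𝓘(ℝ, F) f x).toLinearMap

variable (E) in
/-- `T_x M` as a subspace of `T_{f x} N`. -/
def tangent (f : M → N) (x : M) : Submodule ℝ (TangentSpace 𝓘(ℝ, F) (f x)) :=
  LinearMap.range (mfderiv 𝓘(ℝ, E) 𝓘(ℝ, F) f x).toLinearMap

variable (E) in
/-- `Rad(T_x M) = T_x M ∩ (T_x M)^⊥`, as a subspace of `T_x M`. -/
def radical (g : SemiRiemannianMetric F N) (f : M → N) (x : M) :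
    Submodule ℝ (TangentSpace 𝓘(ℝ, E) x) :=
  ((g.form (f x)).orthogonal (tangent E f x)).comap (mfderiv 𝓘(ℝ, E) 𝓘(ℝ, F) f x).toLinearMap

/-- The covariant derivative `v ↦ ∇_v V` at `x`, for a vector field `V` of `N` along `f` (a
section of the pullback of `TN`), with respect to the connection on this pullback that is induced
by the connection `D` of `N`. If `e i` is the local frame of `TN` around `f x` given by the
trivialization at `f x`, and `V y = ∑ i, c i y • e i (f y)`, this is
`∑ i, (dc i (v) • e i (f x) + c i x • D_{df v} (e i))`. For `V = W ∘ f` it is `D_{df v} W`. -/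
def covAlong (D : CovariantDerivative 𝓘(ℝ, F) F (TangentSpace 𝓘(ℝ, F) : N → Type _)) (f : M → N)
    (V : Π x : M, TangentSpace 𝓘(ℝ, F) (f x)) (x : M) :
    TangentSpace 𝓘(ℝ, E) x →L[ℝ] TangentSpace 𝓘(ℝ, F) (f x) :=
  ((trivializationAt F (TangentSpace 𝓘(ℝ, F) : N → Type _) (f x)).symmL ℝ (f x)) ∘L
      mvfderiv 𝓘(ℝ, E)
        (fun y ↦ ((trivializationAt F (TangentSpace 𝓘(ℝ, F) : N → Type _) (f x)) ⟨f y, V y⟩).2) x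
    + D (FiberBundle.extend F (V x)) (f x) ∘L mfderiv 𝓘(ℝ, E) 𝓘(ℝ, F) f x

end Along

/-! ### Lightlike submanifolds -/

section Lightlike

variable {E : Type*} [NormedAddCommGroup E] [NormedSpace ℝ E] [FiniteDimensional ℝ E]
  {M : Type*} [TopologicalSpace M] [ChartedSpace E M] [IsManifold 𝓘(ℝ, E) ∞ M]
  {F : Type*} [NormedAddCommGroup F] [NormedSpace ℝ F] [FiniteDimensional ℝ F]
  {N : Type*} [TopologicalSpace N] [ChartedSpace F N] [IsManifold 𝓘(ℝ, F) ∞ N]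

variable (E) in
/-- A lightlike submanifold `(M, g, S(TM), S(TM^⊥))`, immersed in `N` by `f`, whose radical
distribution has rank `r ≥ 1`, with a lightlike transversal bundle `ltr(TM)`. A complement of
`Rad(TM)` in `S(TM^⊥)^⊥` (the orthogonal complement being taken in `S(TM)^⊥`) has local frames
`N_i` with `g(N_i, N_j) = 0` and `g(ξ_i, N_j) = δ_ij`, for a local frame `ξ_i` of `Rad(TM)`, if
and only if it is totally null. -/
structure LightlikeSubmanifold (g : SemiRiemannianMetric F N) (f : M → N) (r : ℕ) where
  contMDiff : ContMDiff 𝓘(ℝ, E) 𝓘(ℝ, F) ∞ f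
  injective_mfderiv (x : M) : Function.Injective (mfderiv 𝓘(ℝ, E) 𝓘(ℝ, F) f x)
  rank_pos : 1 ≤ r
  finrank_radical (x : M) : Module.finrank ℝ (radical E g f x) = r
  /-- the screen distribution `S(TM)` -/
  screen (x : M) : Submodule ℝ (TangentSpace 𝓘(ℝ, E) x)
  /-- the screen transversal bundle `S(TM^⊥)` -/
  coscreen (x : M) : Submodule ℝ (TangentSpace 𝓘(ℝ, F) (f x))
  /-- the lightlike transversal bundle `ltr(TM)` -/
  ltr (x : M) : Submodule ℝ (TangentSpace 𝓘(ℝ, F) (f x))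
  screen_smooth : IsDistribution screen
  coscreen_smooth : IsSubbundleAlong E f coscreen
  ltr_smooth : IsSubbundleAlong E f ltr
  screen_nondegenerate (x : M) : IsNondegenerateOn (g.form (f x)) (push f x (screen x))
  coscreen_nondegenerate (x : M) : IsNondegenerateOn (g.form (f x)) (coscreen x)
  screen_sum (x : M) : IsOrthogonalSum (g.form (f x)) (push f x (screen x))
    (push f x (radical E g f x)) (tangent E f x)
  coscreen_sum (x : M) : IsOrthogonalSum (g.form (f x)) (coscreen x)
    (push f x (radical E g f x)) ((g.form (f x)).orthogonal (tangent E f x))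
  ltr_sum (x : M) : IsDirectSum (push f x (radical E g f x)) (ltr x)
    ((g.form (f x)).orthogonal (push f x (screen x) ⊔ coscreen x))
  ltr_null (x : M) : ∀ u ∈ ltr x, ∀ w ∈ ltr x, g.toFun (f x) u w = 0

namespace LightlikeSubmanifold

variable {g : SemiRiemannianMetric F N} {f : M → N} {r : ℕ} (A : LightlikeSubmanifold E g f r)

/-- The transversal vector bundle `tr(TM) = ltr(TM) ⊥ S(TM^⊥)`. -/
def tr (x : M) : Submodule ℝ (TangentSpace 𝓘(ℝ, F) (f x)) :=
  A.ltr x ⊔ A.coscreen x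

theorem isCompl (x : M) :
    IsCompl (tangent E f x) (A.tr x) ∧ IsCompl (A.ltr x) (tangent E f x ⊔ A.coscreen x) :=
  haveI : FiniteDimensional ℝ (TangentSpace 𝓘(ℝ, F) (f x)) := inferInstanceAs (FiniteDimensional ℝ F)
  isCompl_of_decomposition (g.form_isSymm (f x)) (A.screen_sum x) (A.coscreen_sum x)
    (A.screen_nondegenerate x) (A.coscreen_nondegenerate x) (A.ltr_sum x)

/-- The tangential part of a vector of `N`, according to `TN|_M = TM ⊕ tr(TM)`. -/
def tangentPart (x : M) : TangentSpace 𝓘(ℝ, F) (f x) →ₗ[ℝ] TangentSpace 𝓘(ℝ, E) x :=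
  LinearMap.linearProjOfIsCompl (A.tr x) (mfderiv 𝓘(ℝ, E) 𝓘(ℝ, F) f x).toLinearMap
    (A.injective_mfderiv x) (A.isCompl x).1

/-- The transversal part of a vector of `N`, according to `TN|_M = TM ⊕ tr(TM)`. -/
def trPart (x : M) : TangentSpace 𝓘(ℝ, F) (f x) →ₗ[ℝ] TangentSpace 𝓘(ℝ, F) (f x) :=
  Submodule.projection _ _ (A.isCompl x).1.symm

/-- The lightlike transversal part of a vector of `N`, according to
`TN|_M = TM ⊕ (ltr(TM) ⊥ S(TM^⊥))`. -/
def ltrPart (x : M) : TangentSpace 𝓘(ℝ, F) (f x) →ₗ[ℝ] TangentSpace 𝓘(ℝ, F) (f x) :=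
  Submodule.projection _ _ (A.isCompl x).2

variable (D : CovariantDerivative 𝓘(ℝ, F) F (TangentSpace 𝓘(ℝ, F) : N → Type _))

/-- The induced connection: `A.inducedConnection D Y x v` is `∇_v Y`, the tangential part in the
Gauss formula. -/
def inducedConnection (Y : Π x : M, TangentSpace 𝓘(ℝ, E) x) (x : M) :
    TangentSpace 𝓘(ℝ, E) x →ₗ[ℝ] TangentSpace 𝓘(ℝ, E) x :=
  A.tangentPart x ∘ₗ
    (covAlong D f (fun y ↦ mfderiv 𝓘(ℝ, E) 𝓘(ℝ, F) f y (Y y)) x).toLinearMap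

/-- The second fundamental form: `A.h D Y x v` is `h(v, Y)`, the transversal part in the Gauss
formula. -/
def h (Y : Π x : M, TangentSpace 𝓘(ℝ, E) x) (x : M) :
    TangentSpace 𝓘(ℝ, E) x →ₗ[ℝ] TangentSpace 𝓘(ℝ, F) (f x) :=
  A.trPart x ∘ₗ
    (covAlong D f (fun y ↦ mfderiv 𝓘(ℝ, E) 𝓘(ℝ, F) f y (Y y)) x).toLinearMap

/-- The lightlike second fundamental form `h^l`, the part of `h` in `ltr(TM)`. -/
def hl (Y : Π x : M, TangentSpace 𝓘(ℝ, E) x) (x : M) :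
    TangentSpace 𝓘(ℝ, E) x →ₗ[ℝ] TangentSpace 𝓘(ℝ, F) (f x) :=
  A.ltrPart x ∘ₗ A.h D Y x

/-- The induced (degenerate) metric on `M`. -/
def inducedMetric (_A : LightlikeSubmanifold E g f r) (x : M) (v w : TangentSpace 𝓘(ℝ, E) x) : ℝ :=
  g.toFun (f x) (mfderiv 𝓘(ℝ, E) 𝓘(ℝ, F) f x v) (mfderiv 𝓘(ℝ, E) 𝓘(ℝ, F) f x w)

/-- `H` is a transversal curvature vector field of `M`: a smooth section of `tr(TM)` such that
`h(X, Y) = g(X, Y) H` for all vector fields `X`, `Y` tangent to `M`. -/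
structure IsTransversalCurvature (H : Π x : M, TangentSpace 𝓘(ℝ, F) (f x)) : Prop where
  smooth : ContMDiff 𝓘(ℝ, E) 𝓘(ℝ, F).tangent ∞
    (fun x ↦ (⟨f x, H x⟩ : TangentBundle 𝓘(ℝ, F) N))
  mem_tr (x : M) : H x ∈ A.tr x
  h_eq (X Y : Π x : M, TangentSpace 𝓘(ℝ, E) x) (x : M) (hX : FieldDiffAt X x)
    (hY : FieldDiffAt Y x) : A.h D Y x (X x) = A.inducedMetric x (X x) (Y x) • H x

/-- `M` is totally umbilical. -/
def IsTotallyUmbilical : Prop :=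
  ∃ H : Π x : M, TangentSpace 𝓘(ℝ, F) (f x), A.IsTransversalCurvature D H

/-- The induced connection is a metric connection, i.e.
`(∇_X g)(Y, Z) = X g(Y, Z) - g(∇_X Y, Z) - g(Y, ∇_X Z) = 0`. -/
def IsMetricConnection : Prop :=
  ∀ (X Y Z : Π x : M, TangentSpace 𝓘(ℝ, E) x) (x : M),
    FieldDiffAt X x → FieldDiffAt Y x → FieldDiffAt Z x →
    mvfderiv 𝓘(ℝ, E) (fun y ↦ A.inducedMetric y (Y y) (Z y)) x (X x)
      - A.inducedMetric x (A.inducedConnection D Y x (X x)) (Z x)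
      - A.inducedMetric x (Y x) (A.inducedConnection D Z x (X x)) = 0

/-- Screen transversal Cauchy Riemann (STCR) lightlike submanifolds, with the subbundles that are
part of the definition. -/
structure STCR (A : LightlikeSubmanifold E g f r)
    (J : Π p : N, TangentSpace 𝓘(ℝ, F) p →L[ℝ] TangentSpace 𝓘(ℝ, F) p) where
  D₁ (x : M) : Submodule ℝ (TangentSpace 𝓘(ℝ, E) x)
  D₂ (x : M) : Submodule ℝ (TangentSpace 𝓘(ℝ, E) x)
  D₀ (x : M) : Submodule ℝ (TangentSpace 𝓘(ℝ, E) x)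
  /-- the distribution `D'` -/
  D' (x : M) : Submodule ℝ (TangentSpace 𝓘(ℝ, E) x)
  L₁ (x : M) : Submodule ℝ (TangentSpace 𝓘(ℝ, F) (f x))
  S (x : M) : Submodule ℝ (TangentSpace 𝓘(ℝ, F) (f x))
  D₁_smooth : IsDistribution D₁
  D₂_smooth : IsDistribution D₂
  D₀_smooth : IsDistribution D₀
  D'_smooth : IsDistribution D'
  L₁_smooth : IsSubbundleAlong E f L₁
  S_smooth : IsSubbundleAlong E f S
  L₁_le (x : M) : L₁ x ≤ A.ltr x
  S_le (x : M) : S x ≤ A.coscreen x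
  radical_sum (x : M) : IsDirectSum (D₁ x) (D₂ x) (radical E g f x)
  J_D₁ (x : M) : (push f x (D₁ x)).map (J (f x)).toLinearMap ≤ push f x (A.screen x)
  J_D₂ (x : M) : (push f x (D₂ x)).map (J (f x)).toLinearMap ≤ A.coscreen x
  disjoint_J_D₁_D' (x : M) :
    Disjoint ((push f x (D₁ x)).map (J (f x)).toLinearMap) (push f x (D' x))
  screen_sum (x : M) : IsOrthogonalSum (g.form (f x))
    ((push f x (D₁ x)).map (J (f x)).toLinearMap ⊔ push f x (D' x)) (push f x (D₀ x))
    (push f x (A.screen x))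
  J_D₀ (x : M) : (push f x (D₀ x)).map (J (f x)).toLinearMap = push f x (D₀ x)
  D₀_nondegenerate (x : M) : IsNondegenerateOn (g.form (f x)) (push f x (D₀ x))
  J_D' (x : M) : IsOrthogonalSum (g.form (f x)) (L₁ x) (S x)
    ((push f x (D' x)).map (J (f x)).toLinearMap)

end LightlikeSubmanifold

end Lightlike

end LightlikeGeometry

end

open LightlikeGeometry

noncomputable section

namespace LightlikeGeometry

variable {E : Type*} [NormedAddCommGroup E] [NormedSpace ℝ E]
  {M : Type*} [TopologicalSpace M] [ChartedSpace E M]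
  {F : Type*} [NormedAddCommGroup F] [NormedSpace ℝ F]
  {N : Type*} [TopologicalSpace N] [ChartedSpace F N]
  {G : Type*} [NormedAddCommGroup G] [NormedSpace ℝ G]

local notation "𝒯" => trivializationAt F (TangentSpace 𝓘(ℝ, F) : N → Type _)

/-! ### Derivatives of vector-valued functions, read in a chart -/

/-! Write ∇̄ for the Levi-Civita connection, pulled back along the immersion. For sections X, Y of
D₀ the fields JX and JY are again tangent to M, and ∇̄J = 0 gives h(X, JY) = tr(J ∇̄_X Y). Since ∇̄
is torsion-free, h(X, JY) - h(Y, JX) is the transversal part of J[X, Y]. Integrability puts [X, Y]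
in the J-invariant distribution D₀, so this part vanishes. Umbilicity turns the difference into
(g(X, JY) - g(Y, JX)) H, and J is skew for g, so 2 g(X, JY) H = 0. As D₀ is non-zero, non-degenerate
and equal to its image under J, sections with g(X, JY) ≠ 0 exist at each point. Hence all of H
vanishes, not only its lightlike part, and so does all of h. Then ∇̄ and the induced connection
agree on tangent fields, and metric compatibility of ∇̄ restricts to M. This argument is
`STCR.transversalCurvature_eq_zero`. Most of the work before it shows that the connection along f
inherits three properties of ∇̄: it is metric (`mvfderiv_metric_along`), commutes with J
(`IsIndefiniteKahler.covAlong_eq`) and is torsion-free (`covAlong_sub_covAlong`). `covAlong` is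
"derivative of the components plus Christoffel term", the latter being the value of ∇̄ on fields
with constant components. Each property is therefore checked on such constant extensions and then
transferred by the product rule. -/

theorem hasFDerivAt_comp_extChartAt_symm {u : M → G} {x : M}
    (hu : MDifferentiableAt 𝓘(ℝ, E) 𝓘(ℝ, G) u x) :
    HasFDerivAt (𝕜 := ℝ) (E := E) (F := G) (u ∘ (extChartAt 𝓘(ℝ, E) x).symm)
      (mvfderiv 𝓘(ℝ, E) u x) (extChartAt 𝓘(ℝ, E) x x) := by
  have h := hu.hasMFDerivAt.2
  simp only [writtenInExtChartAt, extChartAt_model_space_eq_id, modelWithCornersSelf_coe,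
    range_id] at h
  exact h.hasFDerivAt_of_univ

/-- Near x, u is its chart expression composed with the chart. This transfers rules of calculus in
normed spaces to functions on M. -/
theorem mvfderiv_eq_of_hasFDerivAt [IsManifold 𝓘(ℝ, E) 1 M] {u : M → G} {x : M} {L : E →L[ℝ] G}
    (hu : HasFDerivAt (𝕜 := ℝ) (E := E) (F := G) (u ∘ (extChartAt 𝓘(ℝ, E) x).symm) L
      (extChartAt 𝓘(ℝ, E) x x)) :
    MDifferentiableAt 𝓘(ℝ, E) 𝓘(ℝ, G) u x ∧ mvfderiv 𝓘(ℝ, E) u x = L := by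
  have h1 : MDifferentiableAt 𝓘(ℝ, E) 𝓘(ℝ, G) u x := by
    have h2 : MDifferentiableAt 𝓘(ℝ, E) 𝓘(ℝ, G)
        ((u ∘ (extChartAt 𝓘(ℝ, E) x).symm) ∘ extChartAt 𝓘(ℝ, E) x) x :=
      (hu.differentiableAt.mdifferentiableAt).comp x
        (mdifferentiableAt_extChartAt (mem_chart_source E x))
    refine h2.congr_of_eventuallyEq ?_
    filter_upwards [extChartAt_source_mem_nhds (I := 𝓘(ℝ, E)) x] with y hy
    exact congrArg u ((extChartAt 𝓘(ℝ, E) x).left_inv hy).symm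
  exact ⟨h1, HasFDerivAt.unique (𝕜 := ℝ) (E := E) (F := G)
    (hasFDerivAt_comp_extChartAt_symm h1) hu⟩

theorem mvfderiv_congr {u u' : M → G} {x : M} (h : u =ᶠ[𝓝 x] u') :
    mvfderiv 𝓘(ℝ, E) u x = mvfderiv 𝓘(ℝ, E) u' x := by
  have h0 := h.mfderiv_eq (I := 𝓘(ℝ, E)) (I' := 𝓘(ℝ, G))
  ext v
  exact congrArg (fun L : E →L[ℝ] G ↦ L v) h0

/-! ### Vector fields along a map, read in a trivialization -/

section Trivialization

variable [IsManifold 𝓘(ℝ, F) ∞ N]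

/-- The vector field `V` along `f`, read in the trivialization of `TN` at `p₀`. -/
def inTriv (p₀ : N) (f : M → N) (V : Π x : M, TangentSpace 𝓘(ℝ, F) (f x)) (y : M) : F :=
  (𝒯 p₀ ⟨f y, V y⟩).2

theorem inTriv_eq (p₀ : N) {f : M → N} (V : Π x : M, TangentSpace 𝓘(ℝ, F) (f x)) {y : M}
    (hy : f y ∈ (𝒯 p₀).baseSet) :
    inTriv p₀ f V y = (𝒯 p₀).continuousLinearMapAt ℝ (f y) (V y) :=
  (Trivialization.continuousLinearMapAt_apply_of_mem (R := ℝ) _ hy _).symm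

theorem symmL_inTriv (p₀ : N) {f : M → N} (V : Π x : M, TangentSpace 𝓘(ℝ, F) (f x)) {y : M}
    (hy : f y ∈ (𝒯 p₀).baseSet) :
    (𝒯 p₀).symmL ℝ (f y) (inTriv p₀ f V y) = V y := by
  rw [inTriv_eq _ _ hy, Trivialization.symmL_continuousLinearMapAt _ hy]

theorem extend_eq_symmL {p₀ q : N} (w : TangentSpace 𝓘(ℝ, F) p₀) (hq : q ∈ (𝒯 p₀).baseSet) :
    FiberBundle.extend F w q = (𝒯 p₀).symmL ℝ q (𝒯 p₀ ⟨p₀, w⟩).2 := by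
  rw [Trivialization.symmL_apply _ hq]
  rfl

theorem inTriv_extend {p₀ q : N} (w : TangentSpace 𝓘(ℝ, F) p₀) (hq : q ∈ (𝒯 p₀).baseSet) :
    inTriv p₀ (fun q ↦ q) (FiberBundle.extend F w) q = (𝒯 p₀ ⟨p₀, w⟩).2 := by
  rw [inTriv_eq p₀ (f := fun q ↦ q) _ hq, extend_eq_symmL _ hq]
  exact Trivialization.continuousLinearMapAt_symmL _ hq _

theorem mdifferentiableAt_along_iff {f : M → N} {V : Π x : M, TangentSpace 𝓘(ℝ, F) (f x)} {x : M}
    (hf : MDifferentiableAt 𝓘(ℝ, E) 𝓘(ℝ, F) f x) :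
    MDifferentiableAt 𝓘(ℝ, E) 𝓘(ℝ, F).tangent
      (fun y ↦ (⟨f y, V y⟩ : TangentBundle 𝓘(ℝ, F) N)) x ↔
    MDifferentiableAt 𝓘(ℝ, E) 𝓘(ℝ, F) (inTriv (f x) f V) x := by
  rw [mdifferentiableAt_totalSpace]
  exact and_iff_right hf

theorem eventually_mem_baseSet {f : M → N} {x : M} (hf : ContinuousAt f x) :
    ∀ᶠ y in 𝓝 x, f y ∈ (𝒯 (f x)).baseSet :=
  hf.eventually_mem ((Trivialization.open_baseSet _).mem_nhds
    (FiberBundle.mem_baseSet_trivializationAt' _))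

/-- The extension has constant components near p, so its covariant derivative at p consists of the
Christoffel term alone. -/
theorem mvfderiv_inTriv_extend {p : N} (w : TangentSpace 𝓘(ℝ, F) p) :
    mvfderiv 𝓘(ℝ, F) (inTriv p (fun q ↦ q) (FiberBundle.extend F w)) p = 0 := by
  have h : inTriv p (fun q ↦ q) (FiberBundle.extend F w) =ᶠ[𝓝 p] fun _ ↦ (𝒯 p ⟨p, w⟩).2 := by
    filter_upwards [eventually_mem_baseSet (F := F) (f := fun q : N ↦ q) (x := p) continuousAt_id] with q hq
    exact inTriv_extend w hq
  rw [mvfderiv_congr h]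
  exact mvfderiv_const _

variable [FiniteDimensional ℝ F]

/-- A covariant derivative in terms of the trivialization of the tangent bundle. -/
theorem covariantDerivative_eq
    (D : CovariantDerivative 𝓘(ℝ, F) F (TangentSpace 𝓘(ℝ, F) : N → Type _))
    {W : Π p : N, TangentSpace 𝓘(ℝ, F) p} {p : N}
    (hW : MDifferentiableAt 𝓘(ℝ, F) 𝓘(ℝ, F).tangent
      (fun q ↦ (⟨q, W q⟩ : TangentBundle 𝓘(ℝ, F) N)) p) (u : TangentSpace 𝓘(ℝ, F) p) :
    D W p u = (𝒯 p).symmL ℝ p (mvfderiv 𝓘(ℝ, F) (inTriv p (fun q ↦ q) W) p u)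
      + D (FiberBundle.extend F (W p)) p u := by
  have hid : MDifferentiableAt 𝓘(ℝ, F) 𝓘(ℝ, F) (fun q : N ↦ q) p := mdifferentiableAt_id
  have hp : p ∈ (𝒯 p).baseSet := FiberBundle.mem_baseSet_trivializationAt' _
  have hpe : ∀ᶠ q in 𝓝 p, q ∈ (𝒯 p).baseSet := (Trivialization.open_baseSet _).mem_nhds hp
  have key (W : Π p : N, TangentSpace 𝓘(ℝ, F) p) (hW : MDifferentiableAt 𝓘(ℝ, F) 𝓘(ℝ, F).tangent
      (fun q ↦ (⟨q, W q⟩ : TangentBundle 𝓘(ℝ, F) N)) p) :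
      MDifferentiableAt 𝓘(ℝ, F) 𝓘(ℝ, F) (inTriv p (fun q ↦ q) W) p :=
    (mdifferentiableAt_along_iff hid).1 hW
  -- Both terms obey the same Leibniz rule, so their difference depends only on the value of W at p.
  -- It may thus be evaluated on the constant extension of that value, where the derivative of the
  -- components is zero.
  have hT : TensorialAt 𝓘(ℝ, F) F (fun W : Π p : N, TangentSpace 𝓘(ℝ, F) p ↦
      D W p u - (𝒯 p).symmL ℝ p (mvfderiv 𝓘(ℝ, F) (inTriv p (fun q ↦ q) W) p u)) p := by
    constructor
    · intro a σ ha hσ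
      have h1 : inTriv p (fun q ↦ q) (a • σ) =ᶠ[𝓝 p] a • inTriv p (fun q ↦ q) σ := by
        filter_upwards [hpe] with q hq
        rw [Pi.smul_apply', inTriv_eq p (f := fun q ↦ q) _ hq, inTriv_eq p (f := fun q ↦ q) _ hq,
          Pi.smul_apply']
        exact map_smul _ _ _
      have h2 : mvfderiv 𝓘(ℝ, F) (inTriv p (fun q ↦ q) (a • σ)) p u =
          a p • mvfderiv 𝓘(ℝ, F) (inTriv p (fun q ↦ q) σ) p u +
            mvfderiv 𝓘(ℝ, F) a p u • inTriv p (fun q ↦ q) σ p := by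
        rw [mvfderiv_congr h1, mvfderiv_smul ha (key σ hσ)]
        simp
      have h3 : (𝒯 p).symmL ℝ p (inTriv p (fun q ↦ q) σ p) = σ p :=
        symmL_inTriv p (f := fun q ↦ q) σ hp
      rw [D.isCovariantDerivativeOnUniv.leibniz hσ ha, h2, map_add, map_smul, map_smul, h3]
      simp
      module
    · intro σ σ' hσ hσ'
      have h1 : inTriv p (fun q ↦ q) (σ + σ') =ᶠ[𝓝 p]
          inTriv p (fun q ↦ q) σ + inTriv p (fun q ↦ q) σ' := by
        filter_upwards [hpe] with q hq
        rw [Pi.add_apply, inTriv_eq p (f := fun q ↦ q) _ hq, inTriv_eq p (f := fun q ↦ q) _ hq,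
          inTriv_eq p (f := fun q ↦ q) _ hq]
        exact map_add _ _ _
      have h2 : mvfderiv 𝓘(ℝ, F) (inTriv p (fun q ↦ q) (σ + σ')) p u =
          mvfderiv 𝓘(ℝ, F) (inTriv p (fun q ↦ q) σ) p u
            + mvfderiv 𝓘(ℝ, F) (inTriv p (fun q ↦ q) σ') p u := by
        rw [mvfderiv_congr h1, mvfderiv_add (key σ hσ) (key σ' hσ')]
        rfl
      rw [D.isCovariantDerivativeOnUniv.add hσ hσ', h2, map_add]
      simp
      module
  have hE := FiberBundle.mdifferentiableAt_extend 𝓘(ℝ, F) F (W p)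
  have h := hT.pointwise hW hE (FiberBundle.extend_apply_self _ _).symm
  rw [mvfderiv_inTriv_extend] at h
  simp only [zero_apply, map_zero, sub_zero] at h
  rw [← h]
  abel

end Trivialization

/-! ### The connection along a map: product rule and compatibility with the metric -/

section Along

theorem mvfderiv_clm_apply [IsManifold 𝓘(ℝ, E) 1 M] {H : Type*} [NormedAddCommGroup H]
    [NormedSpace ℝ H] {c : M → H →L[ℝ] G} {u : M → H} {x : M}
    (hc : MDifferentiableAt 𝓘(ℝ, E) 𝓘(ℝ, H →L[ℝ] G) c x)
    (hu : MDifferentiableAt 𝓘(ℝ, E) 𝓘(ℝ, H) u x) :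
    MDifferentiableAt 𝓘(ℝ, E) 𝓘(ℝ, G) (fun y ↦ c y (u y)) x ∧
      ∀ v, mvfderiv 𝓘(ℝ, E) (fun y ↦ c y (u y)) x v =
        mvfderiv 𝓘(ℝ, E) c x v (u x) + c x (mvfderiv 𝓘(ℝ, E) u x v) := by
  have h := HasFDerivAt.clm_apply (hasFDerivAt_comp_extChartAt_symm hc)
    (hasFDerivAt_comp_extChartAt_symm hu)
  obtain ⟨h1, h2⟩ := mvfderiv_eq_of_hasFDerivAt (u := fun y ↦ c y (u y)) h
  refine ⟨h1, fun v ↦ ?_⟩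
  rw [h2, add_comm (mvfderiv 𝓘(ℝ, E) c x v (u x))]
  have hx : (extChartAt 𝓘(ℝ, E) x).symm (extChartAt 𝓘(ℝ, E) x x) = x := extChartAt_to_inv x
  simp only [Function.comp_apply, hx]
  rfl

variable [IsManifold 𝓘(ℝ, E) ∞ M] [IsManifold 𝓘(ℝ, F) ∞ N]

theorem mvfderiv_comp_map {f : M → N} {u : N → G} {x : M}
    (hu : MDifferentiableAt 𝓘(ℝ, F) 𝓘(ℝ, G) u (f x))
    (hf : MDifferentiableAt 𝓘(ℝ, E) 𝓘(ℝ, F) f x) (v : TangentSpace 𝓘(ℝ, E) x) :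
    mvfderiv 𝓘(ℝ, E) (fun y ↦ u (f y)) x v =
      mvfderiv 𝓘(ℝ, F) u (f x) (mfderiv 𝓘(ℝ, E) 𝓘(ℝ, F) f x v) := by
  have h := mfderiv_comp x hu hf
  exact congrArg (fun L : E →L[ℝ] G ↦ L v) h

theorem covAlong_apply (D : CovariantDerivative 𝓘(ℝ, F) F (TangentSpace 𝓘(ℝ, F) : N → Type _))
    (f : M → N) (V : Π x : M, TangentSpace 𝓘(ℝ, F) (f x)) (x : M) (v : TangentSpace 𝓘(ℝ, E) x) :
    covAlong D f V x v = (𝒯 (f x)).symmL ℝ (f x) (mvfderiv 𝓘(ℝ, E) (inTriv (f x) f V) x v)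
      + D (FiberBundle.extend F (V x)) (f x) (mfderiv 𝓘(ℝ, E) 𝓘(ℝ, F) f x v) :=
  rfl

theorem covAlong_congr (D : CovariantDerivative 𝓘(ℝ, F) F (TangentSpace 𝓘(ℝ, F) : N → Type _))
    {f : M → N} {V W : Π x : M, TangentSpace 𝓘(ℝ, F) (f x)} {x : M}
    (h : ∀ᶠ y in 𝓝 x, V y = W y) (v : TangentSpace 𝓘(ℝ, E) x) :
    covAlong D f V x v = covAlong D f W x v := by
  have h1 : inTriv (f x) f V =ᶠ[𝓝 x] inTriv (f x) f W := by
    filter_upwards [h] with y hy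
    rw [inTriv, inTriv, hy]
  rw [covAlong_apply, covAlong_apply, mvfderiv_congr h1, h.self_of_nhds]

variable [FiniteDimensional ℝ F]

/-- The metric, read in the trivialization of `TN` at `p₀`. -/
def SemiRiemannianMetric.coords (g : SemiRiemannianMetric F N) (p₀ q : N) : F →L[ℝ] F →L[ℝ] ℝ :=
  ContinuousLinearMap.inCoordinates F (TangentSpace 𝓘(ℝ, F) : N → Type _) (F →L[ℝ] ℝ)
    (fun q : N ↦ TangentSpace 𝓘(ℝ, F) q →L[ℝ] ℝ) p₀ q p₀ q (g.toFun q)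

theorem SemiRiemannianMetric.mdifferentiableAt_coords (g : SemiRiemannianMetric F N) (p : N) :
    MDifferentiableAt 𝓘(ℝ, F) 𝓘(ℝ, F →L[ℝ] F →L[ℝ] ℝ) (g.coords p) p :=
  ((mdifferentiableAt_hom_bundle _).1
    ((g.smooth p).mdifferentiableAt (by simp))).2

theorem SemiRiemannianMetric.coords_apply (g : SemiRiemannianMetric F N) {p q : N}
    (hq : q ∈ (𝒯 p).baseSet) (a b : F) :
    g.coords p q a b = g.toFun q ((𝒯 p).symmL ℝ q a) ((𝒯 p).symmL ℝ q b) := by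
  rw [coords, inCoordinates_apply_eq₂ hq hq (by simp)]
  simp [Trivialization.symmL_apply _ hq]

/-- Differentiate the product of the matrix of g and the components of V and W. The derivatives of
the components give the first terms of `covAlong`, and the derivative of the matrix gives the
Christoffel terms. -/
theorem mvfderiv_metric_along (g : SemiRiemannianMetric F N)
    {D : CovariantDerivative 𝓘(ℝ, F) F (TangentSpace 𝓘(ℝ, F) : N → Type _)}
    (hD : IsLeviCivita g D) {f : M → N} {V W : Π x : M, TangentSpace 𝓘(ℝ, F) (f x)} {x : M}
    (hf : MDifferentiableAt 𝓘(ℝ, E) 𝓘(ℝ, F) f x)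
    (hV : MDifferentiableAt 𝓘(ℝ, E) 𝓘(ℝ, F).tangent
      (fun y ↦ (⟨f y, V y⟩ : TangentBundle 𝓘(ℝ, F) N)) x)
    (hW : MDifferentiableAt 𝓘(ℝ, E) 𝓘(ℝ, F).tangent
      (fun y ↦ (⟨f y, W y⟩ : TangentBundle 𝓘(ℝ, F) N)) x) (v : TangentSpace 𝓘(ℝ, E) x) :
    mvfderiv 𝓘(ℝ, E) (fun y ↦ g.toFun (f y) (V y) (W y)) x v =
      g.toFun (f x) (covAlong D f V x v) (W x) + g.toFun (f x) (V x) (covAlong D f W x v) := by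
  have hp : f x ∈ (𝒯 (f x)).baseSet := FiberBundle.mem_baseSet_trivializationAt' _
  have hV' := (mdifferentiableAt_along_iff hf).1 hV
  have hW' := (mdifferentiableAt_along_iff hf).1 hW
  have hg := g.mdifferentiableAt_coords (f x)
  have hgf : MDifferentiableAt 𝓘(ℝ, E) 𝓘(ℝ, F →L[ℝ] F →L[ℝ] ℝ) (fun y ↦ g.coords (f x) (f y)) x :=
    hg.comp x hf
  have h1 := mvfderiv_clm_apply hgf hV'
  have h2 := mvfderiv_clm_apply h1.1 hW'
  have h3 : (fun y ↦ g.toFun (f y) (V y) (W y)) =ᶠ[𝓝 x]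
      fun y ↦ g.coords (f x) (f y) (inTriv (f x) f V y) (inTriv (f x) f W y) := by
    filter_upwards [eventually_mem_baseSet (F := F) hf.continuousAt] with y hy
    rw [g.coords_apply hy, symmL_inTriv _ _ hy, symmL_inTriv _ _ hy]
  -- Metric compatibility on the extensions of a and b: their components are constant, so only the
  -- matrix of g is differentiated.
  have h4 (a b : TangentSpace 𝓘(ℝ, F) (f x)) (w : TangentSpace 𝓘(ℝ, F) (f x)) :
      mvfderiv 𝓘(ℝ, F) (g.coords (f x)) (f x) w (𝒯 (f x) ⟨f x, a⟩).2 (𝒯 (f x) ⟨f x, b⟩).2 =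
      g.toFun (f x) (D (FiberBundle.extend F a) (f x) w) b +
        g.toFun (f x) a (D (FiberBundle.extend F b) (f x) w) := by
    have h5 := hD.metric (FiberBundle.extend F a) (FiberBundle.extend F b) (f x)
      (FiberBundle.mdifferentiableAt_extend 𝓘(ℝ, F) F a)
      (FiberBundle.mdifferentiableAt_extend 𝓘(ℝ, F) F b) w
    rw [FiberBundle.extend_apply_self, FiberBundle.extend_apply_self] at h5
    rw [← h5]
    have h6 : (fun q ↦ g.toFun q (FiberBundle.extend F a q) (FiberBundle.extend F b q)) =ᶠ[𝓝 (f x)]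
        fun q ↦ g.coords (f x) q (𝒯 (f x) ⟨f x, a⟩).2 (𝒯 (f x) ⟨f x, b⟩).2 := by
      filter_upwards [(Trivialization.open_baseSet _).mem_nhds hp] with q hq
      rw [g.coords_apply hq, extend_eq_symmL _ hq, extend_eq_symmL _ hq]
    have h7 := mvfderiv_clm_apply hg
      (mdifferentiableAt_const (I := 𝓘(ℝ, F)) (I' := 𝓘(ℝ, F)) (c := (𝒯 (f x) ⟨f x, a⟩).2))
    have h8 := mvfderiv_clm_apply h7.1
      (mdifferentiableAt_const (I := 𝓘(ℝ, F)) (I' := 𝓘(ℝ, F)) (c := (𝒯 (f x) ⟨f x, b⟩).2))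
    rw [mvfderiv_congr h6, h8.2, h7.2, mvfderiv_const, mvfderiv_const]
    simp
  rw [mvfderiv_congr h3, h2.2, h1.2, mvfderiv_comp_map hg hf]
  rw [add_apply]
  rw [show inTriv (f x) f V x = (𝒯 (f x) ⟨f x, V x⟩).2 from rfl,
    show inTriv (f x) f W x = (𝒯 (f x) ⟨f x, W x⟩).2 from rfl, h4]
  rw [g.coords_apply hp, g.coords_apply hp]
  rw [show (𝒯 (f x) ⟨f x, V x⟩).2 = inTriv (f x) f V x from rfl,
    show (𝒯 (f x) ⟨f x, W x⟩).2 = inTriv (f x) f W x from rfl, symmL_inTriv _ _ hp,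
    symmL_inTriv _ _ hp]
  rw [covAlong_apply, covAlong_apply]
  simp only [map_add, add_apply]
  ring

/-- A field of endomorphisms, read in the trivialization of `TN` at `p₀`. -/
def endoCoords (J : Π p : N, TangentSpace 𝓘(ℝ, F) p →L[ℝ] TangentSpace 𝓘(ℝ, F) p) (p₀ q : N) :
    F →L[ℝ] F :=
  ContinuousLinearMap.inCoordinates F (TangentSpace 𝓘(ℝ, F) : N → Type _) F
    (TangentSpace 𝓘(ℝ, F) : N → Type _) p₀ q p₀ q (J q)

theorem endoCoords_apply (J : Π p : N, TangentSpace 𝓘(ℝ, F) p →L[ℝ] TangentSpace 𝓘(ℝ, F) p)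
    {p q : N} (a : F) :
    endoCoords J p q a = (𝒯 p).continuousLinearMapAt ℝ q (J q ((𝒯 p).symmL ℝ q a)) :=
  rfl

/-! ### The complex structure along a map -/

section Endo

variable {g : SemiRiemannianMetric F N}
  {D : CovariantDerivative 𝓘(ℝ, F) F (TangentSpace 𝓘(ℝ, F) : N → Type _)}
  {J : Π p : N, TangentSpace 𝓘(ℝ, F) p →L[ℝ] TangentSpace 𝓘(ℝ, F) p}
  (hN : IsIndefiniteKahler g D J) {f : M → N} {V : Π x : M, TangentSpace 𝓘(ℝ, F) (f x)} {x : M}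
  (hf : MDifferentiableAt 𝓘(ℝ, E) 𝓘(ℝ, F) f x)
  (hV : MDifferentiableAt 𝓘(ℝ, E) 𝓘(ℝ, F).tangent
      (fun y ↦ (⟨f y, V y⟩ : TangentBundle 𝓘(ℝ, F) N)) x)

include hN in
theorem IsIndefiniteKahler.mdifferentiableAt_endoCoords (p : N) :
    MDifferentiableAt 𝓘(ℝ, F) 𝓘(ℝ, F →L[ℝ] F) (endoCoords J p) p :=
  ((mdifferentiableAt_hom_bundle _).1 ((hN.smooth p).mdifferentiableAt (by simp))).2

include hf in
theorem inTriv_endo_eventuallyEq :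
    inTriv (f x) f (fun y ↦ J (f y) (V y)) =ᶠ[𝓝 x]
      fun y ↦ endoCoords J (f x) (f y) (inTriv (f x) f V y) := by
  filter_upwards [eventually_mem_baseSet (F := F) hf.continuousAt] with y hy
  rw [endoCoords_apply, symmL_inTriv _ _ hy, inTriv_eq _ _ hy]

include hN hf hV in
theorem IsIndefiniteKahler.mdifferentiableAt_along :
    MDifferentiableAt 𝓘(ℝ, E) 𝓘(ℝ, F).tangent
      (fun y ↦ (⟨f y, J (f y) (V y)⟩ : TangentBundle 𝓘(ℝ, F) N)) x := by
  rw [mdifferentiableAt_along_iff (V := fun y ↦ J (f y) (V y)) hf]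
  have hJf : MDifferentiableAt 𝓘(ℝ, E) 𝓘(ℝ, F →L[ℝ] F) (fun y ↦ endoCoords J (f x) (f y)) x :=
    (hN.mdifferentiableAt_endoCoords (f x)).comp x hf
  exact (mvfderiv_clm_apply hJf ((mdifferentiableAt_along_iff hf).1 hV)).1.congr_of_eventuallyEq
    (inTriv_endo_eventuallyEq hf)

include hN hf hV in
-- V need not be the restriction of a field on N, so `parallel` does not apply to it directly. It is
-- applied to the constant extension of V x, which determines the derivative of the matrix of J; the
-- product rule does the rest.
theorem IsIndefiniteKahler.covAlong_eq (v : TangentSpace 𝓘(ℝ, E) x) :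
    covAlong D f (fun y ↦ J (f y) (V y)) x v = J (f x) (covAlong D f V x v) := by
  have hp : f x ∈ (𝒯 (f x)).baseSet := FiberBundle.mem_baseSet_trivializationAt' _
  have hJ := hN.mdifferentiableAt_endoCoords (f x)
  have hJf : MDifferentiableAt 𝓘(ℝ, E) 𝓘(ℝ, F →L[ℝ] F) (fun y ↦ endoCoords J (f x) (f y)) x :=
    hJ.comp x hf
  have h1 := mvfderiv_clm_apply hJf ((mdifferentiableAt_along_iff hf).1 hV)
  have hE := FiberBundle.mdifferentiableAt_extend 𝓘(ℝ, F) F (V x)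
  set w := mfderiv 𝓘(ℝ, E) 𝓘(ℝ, F) f x v with hw
  have hid : MDifferentiableAt 𝓘(ℝ, F) 𝓘(ℝ, F) (fun q : N ↦ q) (f x) := mdifferentiableAt_id
  have h2 := hN.parallel (FiberBundle.extend F (V x)) (f x) hE w
  -- J applied to the extension no longer has constant components: its covariant derivative contains
  -- the derivative of the matrix of J, which `h4` and `h5` identify.
  have h3 := covariantDerivative_eq D (W := fun q ↦ J q (FiberBundle.extend F (V x) q))
    (hN.mdifferentiableAt_along (f := fun q ↦ q) hid hE) w
  have h4 : inTriv (f x) (fun q ↦ q) (fun q ↦ J q (FiberBundle.extend F (V x) q)) =ᶠ[𝓝 (f x)]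
      fun q ↦ endoCoords J (f x) q (inTriv (f x) f V x) := by
    filter_upwards [(Trivialization.open_baseSet _).mem_nhds hp,
      inTriv_endo_eventuallyEq (J := J) (f := fun q : N ↦ q) (x := f x)
        (V := FiberBundle.extend F (V x)) hid] with q hq hq'
    rw [hq', inTriv_extend _ hq]
    rfl
  have h5 := mvfderiv_clm_apply hJ (mdifferentiableAt_const (I := 𝓘(ℝ, F)) (I' := 𝓘(ℝ, F))
    (c := inTriv (f x) f V x))
  rw [h2, mvfderiv_congr h4, h5.2, mvfderiv_const, FiberBundle.extend_apply_self] at h3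
  rw [covAlong_apply, covAlong_apply, mvfderiv_congr (inTriv_endo_eventuallyEq hf), h1.2,
    mvfderiv_comp_map hJ hf, map_add, map_add, ← hw, h3, endoCoords_apply,
    Trivialization.symmL_continuousLinearMapAt _ hp]
  simp only [zero_apply, map_zero, add_zero]
  abel

end Endo

end Along

/-! ### Vector fields, brackets and torsion in charts -/

section Charts

variable [IsManifold 𝓘(ℝ, E) ∞ M] [IsManifold 𝓘(ℝ, F) ∞ N]

/-- The vector field `Y`, read in the chart at `x`. -/
def inChart (x : M) (Y : Π x : M, TangentSpace 𝓘(ℝ, E) x) (u : E) : E :=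
  inTriv x (fun y ↦ y) Y ((extChartAt 𝓘(ℝ, E) x).symm u)

theorem inChart_self (x : M) (Y : Π x : M, TangentSpace 𝓘(ℝ, E) x) :
    inChart x Y (extChartAt 𝓘(ℝ, E) x x) = Y x := by
  rw [inChart, extChartAt_to_inv, inTriv_eq x (f := fun y ↦ y) Y
    (FiberBundle.mem_baseSet_trivializationAt' x),
    TangentBundle.continuousLinearMapAt_trivializationAt (mem_chart_source E x),
    mfderiv_extChartAt_self]
  rfl

theorem fieldDiffAt_iff_differentiableAt_inChart {x : M} {Y : Π x : M, TangentSpace 𝓘(ℝ, E) x} :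
    FieldDiffAt Y x ↔ DifferentiableAt ℝ (inChart x Y) (extChartAt 𝓘(ℝ, E) x x) := by
  have hid : MDifferentiableAt 𝓘(ℝ, E) 𝓘(ℝ, E) (fun y : M ↦ y) x := mdifferentiableAt_id
  have h := mdifferentiableAt_along_iff (V := Y) hid
  refine h.trans ⟨fun h ↦ (hasFDerivAt_comp_extChartAt_symm h).differentiableAt, fun h ↦ ?_⟩
  exact (mvfderiv_eq_of_hasFDerivAt (u := inTriv x (fun y ↦ y) Y) h.hasFDerivAt).1

theorem eventually_mem_chart_source (x : M) :
    ∀ᶠ u in 𝓝 (extChartAt 𝓘(ℝ, E) x x), u ∈ (extChartAt 𝓘(ℝ, E) x).target ∧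
      (extChartAt 𝓘(ℝ, E) x).symm u ∈ (chartAt E x).source := by
  filter_upwards [extChartAt_target_mem_nhds (I := 𝓘(ℝ, E)) x] with u hu
  exact ⟨hu, by simpa using (extChartAt 𝓘(ℝ, E) x).map_target hu⟩

theorem mfderiv_symm_inChart {x : M} (Y : Π x : M, TangentSpace 𝓘(ℝ, E) x) {u : E}
    (hu : u ∈ (extChartAt 𝓘(ℝ, E) x).target)
    (hu' : (extChartAt 𝓘(ℝ, E) x).symm u ∈ (chartAt E x).source) :
    mfderiv 𝓘(ℝ, E) 𝓘(ℝ, E) (extChartAt 𝓘(ℝ, E) x).symm u (inChart (E := E) x Y u) =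
      Y ((extChartAt 𝓘(ℝ, E) x).symm u) := by
  have h := symmL_inTriv x (f := fun y : M ↦ y) Y (y := (extChartAt 𝓘(ℝ, E) x).symm u) hu'
  rw [TangentBundle.symmL_trivializationAt hu', (extChartAt 𝓘(ℝ, E) x).right_inv hu,
    modelWithCornersSelf_coe, range_id, mfderivWithin_univ] at h
  exact h

theorem mlieBracket_eq_inChart (X Y : Π x : M, TangentSpace 𝓘(ℝ, E) x) (x : M) :
    VectorField.mlieBracket 𝓘(ℝ, E) X Y x =
      fderiv ℝ (inChart x Y) (extChartAt 𝓘(ℝ, E) x x) (X x)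
        - fderiv ℝ (inChart x X) (extChartAt 𝓘(ℝ, E) x x) (Y x) := by
  have key (Z : Π x : M, TangentSpace 𝓘(ℝ, E) x) :
      VectorField.mpullbackWithin 𝓘(ℝ, E) 𝓘(ℝ, E) (extChartAt 𝓘(ℝ, E) x).symm Z
        (range 𝓘(ℝ, E)) =ᶠ[𝓝 (extChartAt 𝓘(ℝ, E) x x)] inChart x Z := by
    filter_upwards [eventually_mem_chart_source x] with u hu
    rw [VectorField.mpullbackWithin_apply, ← mfderiv_symm_inChart Z hu.1 hu.2,
      modelWithCornersSelf_coe, range_id, mfderivWithin_univ]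
    have hinv := isInvertible_mfderivWithin_extChartAt_symm (I := 𝓘(ℝ, E)) hu.1
    rw [modelWithCornersSelf_coe, range_id, mfderivWithin_univ] at hinv
    exact hinv.inverse_apply_self _
  -- At its own base point the chart has identity differential, so the bracket computed in the chart
  -- needs no pulling back.
  have hinv (w : E) : (mfderiv 𝓘(ℝ, E) 𝓘(ℝ, E) (extChartAt 𝓘(ℝ, E) x) x).inverse w = w := by
    have h := congrArg (fun L : E →L[ℝ] E ↦ L.inverse w) (mfderiv_extChartAt_self (I := 𝓘(ℝ, E))
      (x := x))
    exact h.trans (congrArg (fun L : E →L[ℝ] E ↦ L w) ContinuousLinearMap.inverse_id)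
  rw [← VectorField.mlieBracketWithin_univ, VectorField.mlieBracketWithin_apply]
  refine (hinv _).trans ?_
  rw [(key X).lieBracketWithin_vectorField_eq_nhds (key Y), modelWithCornersSelf_coe, range_id,
    preimage_univ, univ_inter, VectorField.lieBracketWithin_univ, VectorField.lieBracket,
    inChart_self, inChart_self]

/-! ### Fields pushed forward by the immersion -/

section Map

variable {f : M → N} (hf : ContMDiff 𝓘(ℝ, E) 𝓘(ℝ, F) ∞ f) (x : M)

include hf

theorem contDiffAt_writtenInExtChartAt :
    ContDiffAt ℝ 2 (writtenInExtChartAt 𝓘(ℝ, E) 𝓘(ℝ, F) x f) (extChartAt 𝓘(ℝ, E) x x) := by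
  have h := (contMDiffAt_iff.1 (hf x)).2
  rw [modelWithCornersSelf_coe, range_id] at h
  exact (h.contDiffAt univ_mem).of_le ENat.LEInfty.out

theorem mfderiv_eq_fderiv_writtenInExtChartAt :
    mfderiv 𝓘(ℝ, E) 𝓘(ℝ, F) f x =
      fderiv ℝ (writtenInExtChartAt 𝓘(ℝ, E) 𝓘(ℝ, F) x f) (extChartAt 𝓘(ℝ, E) x x) := by
  have h := ((hf x).mdifferentiableAt (by simp)).mfderiv
  rw [modelWithCornersSelf_coe, range_id, fderivWithin_univ] at h
  exact h

/-- The trivialization of TN is the differential of the chart, so this is the chain rule for f read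
in charts. -/
theorem inTriv_push_eventuallyEq (Y : Π x : M, TangentSpace 𝓘(ℝ, E) x) :
    inTriv (f x) f (fun y ↦ mfderiv 𝓘(ℝ, E) 𝓘(ℝ, F) f y (Y y)) ∘ (extChartAt 𝓘(ℝ, E) x).symm
      =ᶠ[𝓝 (extChartAt 𝓘(ℝ, E) x x)]
    fun u ↦ fderiv ℝ (writtenInExtChartAt 𝓘(ℝ, E) 𝓘(ℝ, F) x f) u (inChart x Y u) := by
  have hc : ContinuousAt (f ∘ (extChartAt 𝓘(ℝ, E) x).symm) (extChartAt 𝓘(ℝ, E) x x) :=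
    hf.continuous.continuousAt.comp (continuousAt_extChartAt_symm x)
  have hs : ∀ᶠ u in 𝓝 (extChartAt 𝓘(ℝ, E) x x),
      f ((extChartAt 𝓘(ℝ, E) x).symm u) ∈ (chartAt F (f x)).source := by
    refine hc.eventually_mem ((chartAt F (f x)).open_source.mem_nhds ?_)
    simp only [Function.comp_apply, extChartAt_to_inv]
    exact mem_chart_source F (f x)
  filter_upwards [eventually_mem_chart_source x, hs] with u hu hu'
  have h1 : MDifferentiableAt 𝓘(ℝ, E) 𝓘(ℝ, E) (extChartAt 𝓘(ℝ, E) x).symm u := by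
    have := mdifferentiableWithinAt_extChartAt_symm (I := 𝓘(ℝ, E)) hu.1
    rwa [modelWithCornersSelf_coe, range_id, mdifferentiableWithinAt_univ] at this
  have h2 : MDifferentiableAt 𝓘(ℝ, E) 𝓘(ℝ, F) f ((extChartAt 𝓘(ℝ, E) x).symm u) :=
    (hf _).mdifferentiableAt (by simp)
  have h3 : MDifferentiableAt 𝓘(ℝ, F) 𝓘(ℝ, F) (extChartAt 𝓘(ℝ, F) (f x))
      (f ((extChartAt 𝓘(ℝ, E) x).symm u)) := mdifferentiableAt_extChartAt hu'
  have h4 : mfderiv 𝓘(ℝ, E) 𝓘(ℝ, F) (writtenInExtChartAt 𝓘(ℝ, E) 𝓘(ℝ, F) x f) u =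
      (mfderiv 𝓘(ℝ, F) 𝓘(ℝ, F) (extChartAt 𝓘(ℝ, F) (f x)) (f ((extChartAt 𝓘(ℝ, E) x).symm u))) ∘L
      (mfderiv 𝓘(ℝ, E) 𝓘(ℝ, F) f ((extChartAt 𝓘(ℝ, E) x).symm u)) ∘L
      mfderiv 𝓘(ℝ, E) 𝓘(ℝ, E) (extChartAt 𝓘(ℝ, E) x).symm u := by
    have h5 := mfderiv_comp u (h3.comp _ h2) h1
    rw [mfderiv_comp _ h3 h2] at h5
    exact h5
  rw [mfderiv_eq_fderiv] at h4
  rw [Function.comp_apply, inTriv_eq _ _ hu',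
    TangentBundle.continuousLinearMapAt_trivializationAt hu', h4]
  have h6 := mfderiv_symm_inChart Y hu.1 hu.2
  exact congrArg (fun w ↦ mfderiv 𝓘(ℝ, F) 𝓘(ℝ, F) (extChartAt 𝓘(ℝ, F) (f x)) _
    (mfderiv 𝓘(ℝ, E) 𝓘(ℝ, F) f _ w)) h6.symm

theorem inTriv_push {Y : Π x : M, TangentSpace 𝓘(ℝ, E) x} (hY : FieldDiffAt Y x) :
    MDifferentiableAt 𝓘(ℝ, E) 𝓘(ℝ, F)
      (inTriv (f x) f (fun y ↦ mfderiv 𝓘(ℝ, E) 𝓘(ℝ, F) f y (Y y))) x ∧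
    ∀ v : TangentSpace 𝓘(ℝ, E) x, mvfderiv 𝓘(ℝ, E)
      (inTriv (f x) f (fun y ↦ mfderiv 𝓘(ℝ, E) 𝓘(ℝ, F) f y (Y y))) x v =
        fderiv ℝ (fderiv ℝ (writtenInExtChartAt 𝓘(ℝ, E) 𝓘(ℝ, F) x f)) (extChartAt 𝓘(ℝ, E) x x)
          v (Y x) +
        fderiv ℝ (writtenInExtChartAt 𝓘(ℝ, E) 𝓘(ℝ, F) x f) (extChartAt 𝓘(ℝ, E) x x)
          (fderiv ℝ (inChart x Y) (extChartAt 𝓘(ℝ, E) x x) v) := by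
  have h1 := ((contDiffAt_writtenInExtChartAt hf x).fderiv_right (m := 1)
    one_add_one_eq_two.le).differentiableAt one_ne_zero
  have h2 := h1.hasFDerivAt.clm_apply
    (fieldDiffAt_iff_differentiableAt_inChart.1 hY).hasFDerivAt
  obtain ⟨h3, h4⟩ := mvfderiv_eq_of_hasFDerivAt
    (h2.congr_of_eventuallyEq (inTriv_push_eventuallyEq hf x Y))
  refine ⟨h3, fun v ↦ ?_⟩
  rw [h4, inChart_self, add_comm]
  rfl

theorem fieldDiffAt_push {Y : Π x : M, TangentSpace 𝓘(ℝ, E) x} (hY : FieldDiffAt Y x) :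
    MDifferentiableAt 𝓘(ℝ, E) 𝓘(ℝ, F).tangent
      (fun y ↦ (⟨f y, mfderiv 𝓘(ℝ, E) 𝓘(ℝ, F) f y (Y y)⟩ : TangentBundle 𝓘(ℝ, F) N)) x :=
  (mdifferentiableAt_along_iff (V := fun y ↦ mfderiv 𝓘(ℝ, E) 𝓘(ℝ, F) f y (Y y))
    ((hf x).mdifferentiableAt (by simp))).2 (inTriv_push hf x hY).1

/-- The pullback of a torsion-free connection is torsion-free. -/
theorem covAlong_sub_covAlong [FiniteDimensional ℝ F] {g : SemiRiemannianMetric F N}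
    {D : CovariantDerivative 𝓘(ℝ, F) F (TangentSpace 𝓘(ℝ, F) : N → Type _)}
    (hD : IsLeviCivita g D) {X Y : Π x : M, TangentSpace 𝓘(ℝ, E) x}
    (hX : FieldDiffAt X x) (hY : FieldDiffAt Y x) :
    covAlong D f (fun y ↦ mfderiv 𝓘(ℝ, E) 𝓘(ℝ, F) f y (Y y)) x (X x)
      - covAlong D f (fun y ↦ mfderiv 𝓘(ℝ, E) 𝓘(ℝ, F) f y (X y)) x (Y x) =
    mfderiv 𝓘(ℝ, E) 𝓘(ℝ, F) f x (VectorField.mlieBracket 𝓘(ℝ, E) X Y x) := by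
  -- Symmetry of the Christoffel symbols: fields with constant components have zero bracket at f x.
  have hext (a b : TangentSpace 𝓘(ℝ, F) (f x)) : D (FiberBundle.extend F a) (f x) b =
      D (FiberBundle.extend F b) (f x) a := by
    have h := hD.torsion_free (FiberBundle.extend F b) (FiberBundle.extend F a) (f x)
      (FiberBundle.mdifferentiableAt_extend 𝓘(ℝ, F) F b)
      (FiberBundle.mdifferentiableAt_extend 𝓘(ℝ, F) F a)
    have h0 (c : TangentSpace 𝓘(ℝ, F) (f x)) : fderiv ℝ (inChart (f x) (FiberBundle.extend F c))
        (extChartAt 𝓘(ℝ, F) (f x) (f x)) = 0 := by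
      have h1 : inChart (f x) (FiberBundle.extend F c) =ᶠ[𝓝 (extChartAt 𝓘(ℝ, F) (f x) (f x))]
          fun _ ↦ (𝒯 (f x) ⟨f x, c⟩).2 := by
        filter_upwards [eventually_mem_chart_source (f x)] with u hu
        exact inTriv_extend c hu.2
      rw [h1.fderiv_eq]
      simp
    rw [mlieBracket_eq_inChart, h0, h0, FiberBundle.extend_apply_self,
      FiberBundle.extend_apply_self] at h
    exact sub_eq_zero.1 (h.trans (sub_self (0 : F)))
  -- With the second derivative of f symmetric, the terms containing it cancel, and what remains is
  -- df applied to the chart formula for the bracket.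
  have hsymm : IsSymmSndFDerivAt ℝ (writtenInExtChartAt 𝓘(ℝ, E) 𝓘(ℝ, F) x f)
      (extChartAt 𝓘(ℝ, E) x x) :=
    (contDiffAt_writtenInExtChartAt hf x).isSymmSndFDerivAt (by simp)
  have hp : (𝒯 (f x)).symmL ℝ (f x) = ContinuousLinearMap.id ℝ (TangentSpace 𝓘(ℝ, F) (f x)) := by
    rw [TangentBundle.symmL_trivializationAt (mem_chart_source F (f x)),
      mfderivWithin_range_extChartAt_symm]
    rfl
  rw [covAlong_apply, covAlong_apply, hext _ (mfderiv 𝓘(ℝ, E) 𝓘(ℝ, F) f x (X x)),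
    add_sub_add_right_eq_sub, ← map_sub, (inTriv_push hf x hX).2, (inTriv_push hf x hY).2,
    hsymm.eq (X x) (Y x), add_sub_add_left_eq_sub, ← map_sub, mlieBracket_eq_inChart, hp,
    mfderiv_eq_fderiv_writtenInExtChartAt hf]
  rfl

/-- Let K be f in charts and B a left inverse of its derivative at the base point. Near that point B
∘ DK is invertible, so Y is recovered as (B ∘ DK)⁻¹ B applied to the pushed field, a differentiable
expression. -/
theorem fieldDiffAt_of_push [FiniteDimensional ℝ E] [FiniteDimensional ℝ F]
    (hi : Function.Injective (mfderiv 𝓘(ℝ, E) 𝓘(ℝ, F) f x))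
    {Y : Π x : M, TangentSpace 𝓘(ℝ, E) x}
    (hY : MDifferentiableAt 𝓘(ℝ, E) 𝓘(ℝ, F).tangent
      (fun y ↦ (⟨f y, mfderiv 𝓘(ℝ, E) 𝓘(ℝ, F) f y (Y y)⟩ : TangentBundle 𝓘(ℝ, F) N)) x) :
    FieldDiffAt Y x := by
  rw [fieldDiffAt_iff_differentiableAt_inChart]
  set u₀ := extChartAt 𝓘(ℝ, E) x x
  set K := writtenInExtChartAt 𝓘(ℝ, E) 𝓘(ℝ, F) x f
  have h1 : DifferentiableAt ℝ (fderiv ℝ K) u₀ :=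
    ((contDiffAt_writtenInExtChartAt hf x).fderiv_right (m := 1)
      one_add_one_eq_two.le).differentiableAt one_ne_zero
  have h2 : DifferentiableAt ℝ (inTriv (f x) f (fun y ↦ mfderiv 𝓘(ℝ, E) 𝓘(ℝ, F) f y (Y y)) ∘
      (extChartAt 𝓘(ℝ, E) x).symm) u₀ :=
    (hasFDerivAt_comp_extChartAt_symm ((mdifferentiableAt_along_iff
      (V := fun y ↦ mfderiv 𝓘(ℝ, E) 𝓘(ℝ, F) f y (Y y))
      ((hf x).mdifferentiableAt (by simp))).1 hY)).differentiableAt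
  have hi' : Function.Injective (fderiv ℝ K u₀) := by
    rw [mfderiv_eq_fderiv_writtenInExtChartAt hf] at hi
    exact hi
  obtain ⟨B₀, hB₀⟩ := (fderiv ℝ K u₀).toLinearMap.exists_leftInverse_of_injective
    (LinearMap.ker_eq_bot.2 hi')
  let B : F →L[ℝ] E := LinearMap.toContinuousLinearMap B₀
  have hB : B ∘L fderiv ℝ K u₀ = 1 := by
    ext v
    exact congrArg (fun L : E →ₗ[ℝ] E ↦ L v) hB₀
  have h3 : DifferentiableAt ℝ (fun u ↦ B ∘L fderiv ℝ K u) u₀ :=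
    (differentiableAt_const B).clm_comp h1
  have hu : ∀ᶠ u in 𝓝 u₀, IsUnit (B ∘L fderiv ℝ K u) :=
    h3.continuousAt.eventually_mem (Units.isOpen.mem_nhds (by rw [mem_ofPred_eq, hB]; exact isUnit_one))
  have h4 : DifferentiableAt ℝ (fun u ↦ Ring.inverse (B ∘L fderiv ℝ K u)) u₀ := by
    have h5 : DifferentiableAt ℝ (Ring.inverse : (E →L[ℝ] E) → (E →L[ℝ] E))
        (B ∘L fderiv ℝ K u₀) := by
      rw [hB]
      exact differentiableAt_inverse isUnit_one
    exact h5.comp u₀ h3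
  refine (h4.clm_apply ((differentiableAt_const B).clm_apply h2)).congr_of_eventuallyEq ?_
  filter_upwards [hu, inTriv_push_eventuallyEq hf x Y] with u hu1 hu2
  rw [hu2]
  have h6 := Ring.inverse_mul_cancel _ hu1
  exact (congrArg (fun L : E →L[ℝ] E ↦ L (inChart x Y u)) h6).symm

end Map

end Charts

/-- Take the coefficients of v in a local frame and keep them constant. -/
theorem IsDistribution.exists_local_section [IsManifold 𝓘(ℝ, E) ∞ M]
    {P : Π x : M, Submodule ℝ (TangentSpace 𝓘(ℝ, E) x)} (hP : IsDistribution P) {x : M}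
    {v : TangentSpace 𝓘(ℝ, E) x} (hv : v ∈ P x) :
    ∃ (X : Π x : M, TangentSpace 𝓘(ℝ, E) x) (U : Set M), IsOpen U ∧ x ∈ U ∧ X x = v ∧
      (∀ y ∈ U, X y ∈ P y) ∧ ∀ y ∈ U, ContMDiffAt 𝓘(ℝ, E) 𝓘(ℝ, E).tangent ∞
        (fun z ↦ (⟨z, X z⟩ : TangentBundle 𝓘(ℝ, E) M)) y := by
  obtain ⟨k, s, hs⟩ := hP x
  obtain ⟨U, hU, hUo, hxU⟩ := eventually_nhds_iff.1 hs
  rw [← (hU x hxU).2.2, Submodule.mem_span_range_iff_exists_fun] at hv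
  obtain ⟨c, hc⟩ := hv
  refine ⟨fun y ↦ ∑ i, c i • s i y, U, hUo, hxU, hc, fun y hy ↦ ?_, fun y hy ↦ ?_⟩
  · rw [← (hU y hy).2.2]
    exact Submodule.sum_mem _ fun i _ ↦ Submodule.smul_mem _ _
      (Submodule.subset_span (mem_range_self i))
  · exact ContMDiffAt.sum_section fun i _ ↦ ContMDiffAt.const_smul_section ((hU y hy).1 i)

/-! ### The Gauss formula and the metric property of the induced connection -/

namespace LightlikeSubmanifold

variable [FiniteDimensional ℝ E] [IsManifold 𝓘(ℝ, E) ∞ M] [FiniteDimensional ℝ F]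
  [IsManifold 𝓘(ℝ, F) ∞ N] {g : SemiRiemannianMetric F N} {f : M → N} {r : ℕ}
  (A : LightlikeSubmanifold E g f r)
  {D : CovariantDerivative 𝓘(ℝ, F) F (TangentSpace 𝓘(ℝ, F) : N → Type _)}
  {J : Π p : N, TangentSpace 𝓘(ℝ, F) p →L[ℝ] TangentSpace 𝓘(ℝ, F) p}

theorem trPart_of_mem_tangent {x : M} {w : TangentSpace 𝓘(ℝ, F) (f x)} (hw : w ∈ tangent E f x) :
    A.trPart x w = 0 :=
  Submodule.projection_apply_of_mem_right _ hw

theorem mfderiv_tangentPart_add_trPart (x : M) (w : TangentSpace 𝓘(ℝ, F) (f x)) :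
    mfderiv 𝓘(ℝ, E) 𝓘(ℝ, F) f x (A.tangentPart x w) + A.trPart x w = w := by
  obtain ⟨t, ht, n, hn, rfl⟩ := Submodule.mem_sup.1
    ((A.isCompl x).1.sup_eq_top ▸ Submodule.mem_top : w ∈ tangent E f x ⊔ A.tr x)
  have h1 : A.trPart x n = n := Submodule.projection_apply_of_mem_left _ hn
  have h2 : A.tangentPart x n = 0 := LinearMap.linearProjOfIsCompl_apply_right' _ _ _ _ _ hn
  obtain ⟨v, hv⟩ := ht
  have h3 : A.tangentPart x t = v := by
    rw [← hv]
    exact LinearMap.linearProjOfIsCompl_apply_left _ _ _ _ v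
  have h4 : A.trPart x t = 0 := A.trPart_of_mem_tangent ⟨v, hv⟩
  rw [map_add (A.tangentPart x), map_add (A.trPart x), h1, h2, h3, h4, add_zero, zero_add]
  exact congrArg (· + n) hv

theorem mfderiv_tangentPart {x : M} {w : TangentSpace 𝓘(ℝ, F) (f x)} (hw : w ∈ tangent E f x) :
    mfderiv 𝓘(ℝ, E) 𝓘(ℝ, F) f x (A.tangentPart x w) = w := by
  have h := A.mfderiv_tangentPart_add_trPart x w
  rwa [A.trPart_of_mem_tangent hw, add_zero] at h

/-- If the second fundamental form vanishes, then the induced connection is metric. -/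
theorem isMetricConnection_of_h_eq_zero (hD : IsLeviCivita g D)
    (hh : ∀ (X Y : Π x : M, TangentSpace 𝓘(ℝ, E) x) (x : M), FieldDiffAt X x → FieldDiffAt Y x →
      A.h D Y x (X x) = 0) : A.IsMetricConnection D := by
  intro X Y Z x hX hY hZ
  have key (W : Π x : M, TangentSpace 𝓘(ℝ, E) x) (hW : FieldDiffAt W x) :
      mfderiv 𝓘(ℝ, E) 𝓘(ℝ, F) f x (A.inducedConnection D W x (X x)) =
        covAlong D f (fun y ↦ mfderiv 𝓘(ℝ, E) 𝓘(ℝ, F) f y (W y)) x (X x) := by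
    have h1 := A.mfderiv_tangentPart_add_trPart x
      (covAlong D f (fun y ↦ mfderiv 𝓘(ℝ, E) 𝓘(ℝ, F) f y (W y)) x (X x))
    have h2 : A.trPart x (covAlong D f (fun y ↦ mfderiv 𝓘(ℝ, E) 𝓘(ℝ, F) f y (W y)) x (X x)) = 0 :=
      hh X W x hX hW
    rwa [h2, add_zero] at h1
  have h := mvfderiv_metric_along g hD
    (V := fun y ↦ mfderiv 𝓘(ℝ, E) 𝓘(ℝ, F) f y (Y y))
    (W := fun y ↦ mfderiv 𝓘(ℝ, E) 𝓘(ℝ, F) f y (Z y))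
    ((A.contMDiff x).mdifferentiableAt (by simp))
    (fieldDiffAt_push A.contMDiff x hY) (fieldDiffAt_push A.contMDiff x hZ) (X x)
  simp only [inducedMetric]
  rw [h, key Y hY, key Z hZ]
  ring

/-! ### The J-invariant distribution D₀ and the vanishing of H -/

section JInvariant

variable {A}

theorem STCR.J_mem_push (B : A.STCR J) {x : M} {v : TangentSpace 𝓘(ℝ, E) x} (hv : v ∈ B.D₀ x) :
    J (f x) (mfderiv 𝓘(ℝ, E) 𝓘(ℝ, F) f x v) ∈ push f x (B.D₀ x) := by
  rw [← B.J_D₀ x]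
  exact Submodule.mem_map_of_mem (Submodule.mem_map_of_mem hv)

theorem push_le_tangent (f : M → N) (x : M) (P : Submodule ℝ (TangentSpace 𝓘(ℝ, E) x)) :
    push (F := F) f x P ≤ tangent E f x :=
  LinearMap.map_le_range

/-- J maps D₀ onto itself, so a vector a orthogonal to every Jb would be orthogonal to all of D₀,
hence zero. -/
theorem STCR.exists_metric_J_ne_zero (B : A.STCR J) {x : M} (hx : B.D₀ x ≠ ⊥) :
    ∃ a ∈ B.D₀ x, ∃ b ∈ B.D₀ x, g.toFun (f x) (mfderiv 𝓘(ℝ, E) 𝓘(ℝ, F) f x a)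
      (J (f x) (mfderiv 𝓘(ℝ, E) 𝓘(ℝ, F) f x b)) ≠ 0 := by
  obtain ⟨a, ha, ha0⟩ := Submodule.exists_mem_ne_zero_of_ne_bot hx
  by_contra! h
  refine ha0 (A.injective_mfderiv x ?_)
  rw [map_zero]
  refine B.D₀_nondegenerate x _ (Submodule.mem_map_of_mem ha) fun w hw ↦ ?_
  rw [← B.J_D₀ x] at hw
  obtain ⟨_, ⟨b, hb, rfl⟩, rfl⟩ := hw
  exact h a ha b hb

/-- For sections `X`, `Y` of `D₀`, the field `JY` is tangent to `M`, and
`h(X, JY)` is the transversal part of `J` applied to the derivative of `Y`. -/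
theorem STCR.h_J (hN : IsIndefiniteKahler g D J) (B : A.STCR J)
    {Y : Π x : M, TangentSpace 𝓘(ℝ, E) x} {x : M} (hY : FieldDiffAt Y x)
    (hYD : ∀ᶠ y in 𝓝 x, Y y ∈ B.D₀ y) :
    FieldDiffAt (fun y ↦ A.tangentPart y (J (f y) (mfderiv 𝓘(ℝ, E) 𝓘(ℝ, F) f y (Y y)))) x ∧
    ∀ v, A.h D (fun y ↦ A.tangentPart y (J (f y) (mfderiv 𝓘(ℝ, E) 𝓘(ℝ, F) f y (Y y)))) x v =
      A.trPart x (J (f x)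
        (covAlong D f (fun y ↦ mfderiv 𝓘(ℝ, E) 𝓘(ℝ, F) f y (Y y)) x v)) := by
  have hf : MDifferentiableAt 𝓘(ℝ, E) 𝓘(ℝ, F) f x := (A.contMDiff x).mdifferentiableAt (by simp)
  have h1 : ∀ᶠ y in 𝓝 x, mfderiv 𝓘(ℝ, E) 𝓘(ℝ, F) f y
      (A.tangentPart y (J (f y) (mfderiv 𝓘(ℝ, E) 𝓘(ℝ, F) f y (Y y)))) =
      J (f y) (mfderiv 𝓘(ℝ, E) 𝓘(ℝ, F) f y (Y y)) := by
    filter_upwards [hYD] with y hy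
    exact A.mfderiv_tangentPart (push_le_tangent _ _ _ (B.J_mem_push hy))
  have h2 := fieldDiffAt_push A.contMDiff x hY
  constructor
  -- The tangential part is not known to vary differentiably; but here its push-forward is JY near
  -- x, which is differentiable along f, and f is an immersion.
  · refine fieldDiffAt_of_push A.contMDiff x (A.injective_mfderiv x) ?_
    refine (hN.mdifferentiableAt_along (V := fun y ↦ mfderiv 𝓘(ℝ, E) 𝓘(ℝ, F) f y (Y y))
      hf h2).congr_of_eventuallyEq ?_
    filter_upwards [h1] with y hy
    rw [hy]
  · intro v
    rw [← hN.covAlong_eq (V := fun y ↦ mfderiv 𝓘(ℝ, E) 𝓘(ℝ, F) f y (Y y)) hf h2,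
      ← covAlong_congr D h1]
    rfl

/-- The transversal part of J[X, Y] is zero by integrability and equals 2 g(X, JY) H by umbilicity;
X and Y are chosen to make the factor non-zero at x. -/
theorem STCR.transversalCurvature_eq_zero (hN : IsIndefiniteKahler g D J) (B : A.STCR J)
    (hint : IsIntegrable B.D₀) {H : Π x : M, TangentSpace 𝓘(ℝ, F) (f x)}
    (hH : A.IsTransversalCurvature D H) {x : M} (hx : B.D₀ x ≠ ⊥) : H x = 0 := by
  obtain ⟨a, ha, b, hb, hab⟩ := B.exists_metric_J_ne_zero hx
  obtain ⟨X, U, hU, hxU, rfl, hXD, hXs⟩ := B.D₀_smooth.exists_local_section ha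
  obtain ⟨Y, W, hW, hxW, rfl, hYD, hYs⟩ := B.D₀_smooth.exists_local_section hb
  have hXd : FieldDiffAt X x := (hXs x hxU).mdifferentiableAt (by simp)
  have hYd : FieldDiffAt Y x := (hYs x hxW).mdifferentiableAt (by simp)
  have hXe : ∀ᶠ y in 𝓝 x, X y ∈ B.D₀ y := eventually_of_mem (hU.mem_nhds hxU) hXD
  have hYe : ∀ᶠ y in 𝓝 x, Y y ∈ B.D₀ y := eventually_of_mem (hW.mem_nhds hxW) hYD
  obtain ⟨hJX, hJX'⟩ := B.h_J hN hXd hXe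
  obtain ⟨hJY, hJY'⟩ := B.h_J hN hYd hYe
  have hbr : VectorField.mlieBracket 𝓘(ℝ, E) X Y x ∈ B.D₀ x :=
    hint X Y (U ∩ W) (hU.inter hW) (fun y hy ↦ (hXs y hy.1).contMDiffWithinAt)
      (fun y hy ↦ (hYs y hy.2).contMDiffWithinAt) (fun y hy ↦ ⟨hXD y hy.1, hYD y hy.2⟩) x
      ⟨hxU, hxW⟩
  have h1 := hH.h_eq X _ x hXd hJY
  have h2 := hH.h_eq Y _ x hYd hJX
  have h3 : A.trPart x (J (f x) (mfderiv 𝓘(ℝ, E) 𝓘(ℝ, F) f x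
      (VectorField.mlieBracket 𝓘(ℝ, E) X Y x))) = 0 :=
    A.trPart_of_mem_tangent (push_le_tangent _ _ _ (B.J_mem_push hbr))
  -- The torsion-free identity replaces J[X, Y] by J ∇̄_X Y - J ∇̄_Y X, whose transversal part is
  -- h(X, JY) - h(Y, JX).
  rw [← covAlong_sub_covAlong A.contMDiff x hN.leviCivita hXd hYd, map_sub, map_sub, ← hJX', ← hJY',
    h1, h2, ← sub_smul] at h3
  refine (smul_eq_zero.1 h3).resolve_left ?_
  simp only [inducedMetric]
  -- The Hermitian identity and J² = -1 give g(Y, JX) = -g(X, JY), so the two terms add up instead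
  -- of cancelling.
  rw [A.mfderiv_tangentPart (push_le_tangent _ _ _ (B.J_mem_push ha)),
    A.mfderiv_tangentPart (push_le_tangent _ _ _ (B.J_mem_push hb)),
    ← hN.hermitian (f x) (mfderiv 𝓘(ℝ, E) 𝓘(ℝ, F) f x (Y x)), hN.sq, map_neg,
    g.symm (f x) (J (f x) (mfderiv 𝓘(ℝ, E) 𝓘(ℝ, F) f x (Y x)))]
  intro h
  apply hab
  linarith

end JInvariant

end LightlikeSubmanifold

end LightlikeGeometry

end

/-! ### The main theorem -/

theorem theorem4p1
    {E : Type*} [NormedAddCommGroup E] [NormedSpace ℝ E] [FiniteDimensional ℝ E]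
    {M : Type*} [TopologicalSpace M] [ChartedSpace E M] [IsManifold 𝓘(ℝ, E) ∞ M]
    {F : Type*} [NormedAddCommGroup F] [NormedSpace ℝ F] [FiniteDimensional ℝ F]
    {N : Type*} [TopologicalSpace N] [ChartedSpace F N] [IsManifold 𝓘(ℝ, F) ∞ N]
    (g : SemiRiemannianMetric F N)
    (D : CovariantDerivative 𝓘(ℝ, F) F (TangentSpace 𝓘(ℝ, F) : N → Type _))
    (J : Π p : N, TangentSpace 𝓘(ℝ, F) p →L[ℝ] TangentSpace 𝓘(ℝ, F) p)
    (hN : IsIndefiniteKahler g D J)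
    {f : M → N} {r : ℕ} (A : LightlikeSubmanifold E g f r) (B : A.STCR J)
    (hA : A.IsTotallyUmbilical D)
    (hD₀ : ∀ x, B.D₀ x ≠ ⊥) (hint : IsIntegrable B.D₀) :
    (∀ H : Π x : M, TangentSpace 𝓘(ℝ, F) (f x), A.IsTransversalCurvature D H →
      ∀ x, A.ltrPart x (H x) = 0) ∧
    (∀ (X Y : Π x : M, TangentSpace 𝓘(ℝ, E) x) (x : M), FieldDiffAt X x → FieldDiffAt Y x →
      A.hl D Y x (X x) = 0) ∧
    A.IsMetricConnection D := by
  -- The full vector H vanishes; all three conclusions follow from this.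
  have hzero (H : Π x : M, TangentSpace 𝓘(ℝ, F) (f x)) (hH : A.IsTransversalCurvature D H)
      (x : M) : H x = 0 :=
    B.transversalCurvature_eq_zero hN hint hH (hD₀ x)
  obtain ⟨H, hH⟩ := hA
  have hh (X Y : Π x : M, TangentSpace 𝓘(ℝ, E) x) (x : M) (hX : FieldDiffAt X x)
      (hY : FieldDiffAt Y x) : A.h D Y x (X x) = 0 := by
    rw [hH.h_eq X Y x hX hY, hzero H hH x, smul_zero]
  refine ⟨fun H hH x ↦ by rw [hzero H hH x, map_zero], fun X Y x hX hY ↦ ?_,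
    A.isMetricConnection_of_h_eq_zero hN.leviCivita hh⟩
  rw [LightlikeSubmanifold.hl, LinearMap.comp_apply, hh X Y x hX hY, map_zero]
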